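/- Words are elements of the free semigroup $\mathfrak A^+$ over a countably infinite alphabet $\mathfrak A$ of variables, and an identity is a pair of words, written $\mathbf u\approx\mathbf v$. A variable is linear in a word if it occurs in it exactly once and non-linear if it occurs more than once. For a set $\mathfrak X$ of variables, $\mathbf u(\mathfrak X)$ is the (possibly empty) word obtained from $\mathbf u$ by deleting all occurrences of variables not in $\mathfrak X$, and $\mathrm{lin}(\mathbf u)$ is the set of linear variables of $\mathbf u$. An identity $\mathbf u\approx\mathbf v$ is almost-linear if each of $\mathbf u$ and $\mathbf v$ has at most one non-linear variable; it is block-balanced if $\mathbf u(\{x\}\cup\mathrm{lin}(\mathbf u))=\mathbf v(\{x\}\cup\mathrm{lin}(\mathbf u))$ for every variable $x$. A basis of the identities of a semigroup $S$ is a set of identities of $S$ from which all identities of $S$ can be derived by the equational logic of semigroups, and $S$ is finitely based if it has a finite basis. Let $$\sigma_1:\ xyt_1xt_2y\approx yxt_1xt_2y,\qquad \sigma_\mu:\ xt_1xyt_2y\approx xt_1yxt_2y,\qquad \sigma_2:\ xt_1yt_2xy\approx xt_1yt_2yx .$$ **Theorem.** Let $S$ be a monoid that satisfies $\sigma_1$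 and $\sigma_\mu$, or (dually) $\sigma_\mu$ and $\sigma_2$. Then $S$ is finitely based; moreover, the identities of $S$ have a finite basis in which every identity is almost-linear or is a block-balanced identity with exactly two non-linear variables. -/

import Mathlib

namespace SemigroupIdentity

/-- Words: elements of the free semigroup over the countably infinite alphabet `ℕ` of variables. -/
abbrev Word : Type := FreeSemigroup ℕ

/-- The (nonempty) sequence of letters of a word. -/
def letters (u : Word) : List ℕ := u.head :: u.tail

/-- A semigroup identity `lhs ≈ rhs`. -/
@[ext]
structure Identity where
  lhs : Word
  rhs : Word

/-- The semigroup `S` satisfies the identity `e`: both sides take the same value under every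
assignment of elements of `S` to the variables. -/
def Satisfies (S : Type*) [Semigroup S] (e : Identity) : Prop :=
  ∀ φ : ℕ → S, FreeSemigroup.lift φ e.lhs = FreeSemigroup.lift φ e.rhs

/-- The equational theory of `S`: the set of all identities holding in `S`. -/
def equationalTheory (S : Type*) [Semigroup S] : Set Identity :=
  {e | Satisfies S e}

/-- `Derives A u v`: the identity `u ≈ v` can be derived from the set of identities `A` by the
rules of equational logic for semigroups (substitution of words for variables, reflexivity,
symmetry, transitivity, compatibility with multiplication). -/
inductive Derives (A : Set Identity) : Word → Word → Prop
  | subst (e : Identity) (he : e ∈ A) (φ : ℕ → Word) :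
      Derives A (FreeSemigroup.lift φ e.lhs) (FreeSemigroup.lift φ e.rhs)
  | refl (u : Word) : Derives A u u
  | symm {u v : Word} : Derives A u v → Derives A v u
  | trans {u v w : Word} : Derives A u v → Derives A v w → Derives A u w
  | mul {u v u' v' : Word} : Derives A u v → Derives A u' v' → Derives A (u * u') (v * v')

/-- `B` is a basis of the set of identities `A`: a subset of `A` from which all identities in
`A` can be derived. -/
def IsBasis (B A : Set Identity) : Prop :=
  B ⊆ A ∧ ∀ e ∈ A, Derives B e.lhs e.rhs

/-- A semigroup is finitely based if all its identities can be derived from finitely many of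
them. -/
def FinitelyBased (S : Type*) [Semigroup S] : Prop :=
  ∃ B : Set Identity, B.Finite ∧ IsBasis B (equationalTheory S)

/-- The number of occurrences of the variable `x` in the word `u`. -/
def occ (u : Word) (x : ℕ) : ℕ := (letters u).count x

/-- The set of linear variables of `u`: those occurring exactly once. -/
def lin (u : Word) : Set ℕ := {x | occ u x = 1}

/-- The set of non-linear variables of `u`: those occurring more than once. -/
def non (u : Word) : Set ℕ := {x | 1 < occ u x}

open Classical in
/-- The possibly empty word `u(X)` obtained from `u` by deleting all occurrences of all
variables that are not in `X`. -/
noncomputable def restrict (u : Word) (X : Set ℕ) : List ℕ :=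
  (letters u).filter (fun z => z ∈ X)

/-- A word is almost-linear if it contains at most one non-linear variable. -/
def AlmostLinearWord (u : Word) : Prop := (non u).Subsingleton

/-- An identity is almost-linear if both its sides are almost-linear words. -/
def AlmostLinear (e : Identity) : Prop :=
  AlmostLinearWord e.lhs ∧ AlmostLinearWord e.rhs

/-- An identity `u ≈ v` is block-balanced if `u(x, lin u) = v(x, lin u)` for every variable
`x`. -/
def BlockBalanced (e : Identity) : Prop :=
  ∀ x : ℕ, restrict e.lhs (insert x (lin e.lhs)) = restrict e.rhs (insert x (lin e.lhs))

/-- An identity with (exactly) two non-linear variables: both sides have the same two non-linear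
variables `x ≠ y`. -/
def HasTwoNonlinear (e : Identity) : Prop :=
  ∃ x y : ℕ, x ≠ y ∧ non e.lhs = {x, y} ∧ non e.rhs = {x, y}

/-- `σ_μ`, that is `x t₁ x y t₂ y ≈ x t₁ y x t₂ y`, with `x, y, t₁, t₂` the variables
`0, 1, 2, 3`. -/
def sigmaMu : Identity := ⟨⟨0, [2, 0, 1, 3, 1]⟩, ⟨0, [2, 1, 0, 3, 1]⟩⟩

/-- `σ₁`, that is `x y t₁ x t₂ y ≈ y x t₁ x t₂ y`, with `x, y, t₁, t₂` the variables
`0, 1, 2, 3`. -/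
def sigmaOne : Identity := ⟨⟨0, [1, 2, 0, 3, 1]⟩, ⟨1, [0, 2, 0, 3, 1]⟩⟩

/-- `σ₂`, that is `x t₁ y t₂ x y ≈ x t₁ y t₂ y x`, with `x, y, t₁, t₂` the variables
`0, 1, 2, 3`. -/
def sigmaTwo : Identity := ⟨⟨0, [2, 1, 3, 0, 1]⟩, ⟨0, [2, 1, 3, 1, 0]⟩⟩

end SemigroupIdentity

open SemigroupIdentity

/-! Words are handled as lists, so that substitutions may erase letters. `T` stands for all
identities of the monoid and `R` for those obtained from a candidate basis; both are fully invariant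
congruences containing `σ₁` and `σ_μ`. These two identities let adjacent occurrences of two
non-linear letters commute unless both are last occurrences (`IsSigmaFI.swap`). The order of last
occurrences is therefore the only rigid information about how different non-linear letters are
interleaved between linear ones.

Let `u ≈ v` hold in a non-commutative `S`. Then `u` and `v` have the same letters and, unless some
`x ≈ xⁿ` with `n ≥ 2` holds, the same linear letters in the same order. If such an identity holds,
raising every letter to the power `n` removes all linear letters. For each non-linear `x`,
restricting to `x` and the linear letters gives an almost-linear identity, which can be applied
inside `u` without affecting the position of any other letter relative to the linear ones
(`IsSigmaFI.exists_apply_almostLinear`). After doing this for every `x`, the word is balanced with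
`v`. What remains is to reorder last occurrences; each such swap follows from an identity `p c y ≈ p
y c` of `S` in which only `c` and `y` are non-linear (`IsSigmaFI.swap_last`).

It remains to see that finitely many identities of these two kinds suffice. Almost-linear words are
coded by lists of exponents, and words with two non-linear letters by lists of pairs of exponents.
If one code embeds in another, an identity for the first applies to the second. By Higman's lemma
these codes are well-quasi-ordered, so finitely many minimal ones are enough
(`exists_finite_almostLinear`, `exists_finite_swaps`). To return to semigroup logic, all deletions
of letters are added to the finite set.

Commutative monoids need only `xy ≈ yx` and at most one further identity, and the dual hypothesis is
treated by passing to `Sᵐᵒᵖ`. -/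

namespace SemigroupIdentity

/-! ### Restriction of words to a set of letters -/

/-- The list obtained from `l` by keeping only the letters in `K`. -/
def keep (K : Finset ℕ) (l : List ℕ) : List ℕ := l.filter (fun z => decide (z ∈ K))

@[simp] theorem keep_nil (K : Finset ℕ) : keep K [] = [] := rfl

@[simp] theorem keep_append (K : Finset ℕ) (l m : List ℕ) :
    keep K (l ++ m) = keep K l ++ keep K m := by simp [keep]

@[simp] theorem mem_keep {K : Finset ℕ} {l : List ℕ} {x : ℕ} :
    x ∈ keep K l ↔ x ∈ l ∧ x ∈ K := by simp [keep]

theorem keep_cons_of_mem {K : Finset ℕ} {x : ℕ} (h : x ∈ K) (l : List ℕ) :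
    keep K (x :: l) = x :: keep K l := by simp [keep, h]

theorem keep_cons_of_notMem {K : Finset ℕ} {x : ℕ} (h : x ∉ K) (l : List ℕ) :
    keep K (x :: l) = keep K l := by simp [keep, h]

theorem keep_keep (K M : Finset ℕ) (l : List ℕ) : keep K (keep M l) = keep (K ∩ M) l := by
  simp [keep, List.filter_filter]

theorem keep_eq_nil {K : Finset ℕ} {l : List ℕ} : keep K l = [] ↔ ∀ x ∈ l, x ∉ K := by
  simp [keep]

theorem keep_eq_self {K : Finset ℕ} {l : List ℕ} (h : ∀ x ∈ l, x ∈ K) : keep K l = l := by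
  simpa [keep, List.filter_eq_self] using h

theorem keep_congr {K M : Finset ℕ} {l : List ℕ} (h : ∀ x ∈ l, x ∈ K ↔ x ∈ M) :
    keep K l = keep M l := by
  unfold keep
  exact List.filter_congr fun x hx => by simp [h x hx]

theorem count_keep {K : Finset ℕ} {x : ℕ} (h : x ∈ K) (l : List ℕ) :
    (keep K l).count x = l.count x := by
  unfold keep
  rw [List.count_filter]
  simpa using h

theorem keep_flatMap (K : Finset ℕ) (l : List ℕ) (φ : ℕ → List ℕ) :
    keep K (l.flatMap φ) = l.flatMap fun x => keep K (φ x) := by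
  unfold keep
  rw [List.filter_flatMap]

theorem flatMap_keep (K : Finset ℕ) (l : List ℕ) (φ : ℕ → List ℕ) :
    (keep K l).flatMap φ = l.flatMap fun x => if x ∈ K then φ x else [] := by
  induction l with
  | nil => rfl
  | cons a l ih =>
    by_cases h : a ∈ K
    · simp [keep_cons_of_mem h, h, ih]
    · simp [keep_cons_of_notMem h, h, ih]

theorem flatMap_congr_mem {l : List ℕ} {φ ψ : ℕ → List ℕ} (h : ∀ x ∈ l, φ x = ψ x) :
    l.flatMap φ = l.flatMap ψ := by
  induction l with
  | nil => rfl
  | cons a l ih =>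
    simp only [List.flatMap_cons]
    rw [h a (by simp), ih fun x hx => h x (by simp [hx])]

theorem flatMap_id {l : List ℕ} {φ : ℕ → List ℕ} (h : ∀ x ∈ l, φ x = [x]) :
    l.flatMap φ = l := by
  rw [flatMap_congr_mem h]; simp

/-! ### Balanced pairs of words -/

/-- Two words over the letters become equal after keeping the letters of `L` and one more letter. -/
def Bal (L : Finset ℕ) (u v : List ℕ) : Prop := ∀ x, keep (insert x L) u = keep (insert x L) v

theorem Bal.count_eq {L : Finset ℕ} {u v : List ℕ} (h : Bal L u v) (x : ℕ) :
    u.count x = v.count x := by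
  rw [← count_keep (Finset.mem_insert_self x L), h x, count_keep (Finset.mem_insert_self x L)]

theorem Bal.mem_iff {L : Finset ℕ} {u v : List ℕ} (h : Bal L u v) (x : ℕ) : x ∈ u ↔ x ∈ v := by
  rw [← List.count_pos_iff, h.count_eq, List.count_pos_iff]

theorem exists_eq_append_cons_last {x : ℕ} {l : List ℕ} (h : x ∈ l) :
    ∃ p q, l = p ++ x :: q ∧ x ∉ q := by
  obtain ⟨a, b, hab, ha⟩ := List.eq_append_cons_of_mem (List.mem_reverse.2 h)
  refine ⟨b.reverse, a.reverse, ?_, by simpa using ha⟩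
  rw [← List.reverse_reverse l, hab]
  simp

theorem append_cons_append_inj_last {x : ℕ} {a b p q : List ℕ}
    (h : a ++ x :: b = p ++ x :: q) (hb : x ∉ b) (hq : x ∉ q) : a = p ∧ b = q := by
  have h' := congrArg List.reverse h
  simp only [List.reverse_append, List.reverse_cons, List.append_assoc, List.singleton_append] at h'
  have := List.append_eq_append_iff.1 h'
  rcases this with ⟨as, h1, h2⟩ | ⟨as, h1, h2⟩
  · cases as with
    | nil => simp at h1 h2; exact ⟨h2, h1.symm⟩
    | cons c as =>
      simp at h2
      obtain ⟨rfl, h2⟩ := h2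
      exfalso; apply hq; rw [← List.mem_reverse, h1]; simp
  · cases as with
    | nil => simp at h1 h2; exact ⟨h2.symm, h1⟩
    | cons c as =>
      simp at h2
      obtain ⟨rfl, h2⟩ := h2
      exfalso; apply hb; rw [← List.mem_reverse, h1]; simp

/-- In a word balanced with `b ++ [c]`, the last occurrence of `c` is in the final block. -/
theorem Bal.exists_split {L : Finset ℕ} {p b : List ℕ} {c : ℕ} (h : Bal L p (b ++ [c])) :
    ∃ a w, p = a ++ c :: w ∧ c ∉ w ∧ (∀ z ∈ w, z ∉ L) ∧ (c ∈ L → w = []) ∧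
      Bal L (a ++ w) b := by
  have hc : c ∈ p := (h.mem_iff c).2 (by simp)
  obtain ⟨a, w, rfl, hw⟩ := exists_eq_append_cons_last hc
  -- Whenever `c` is among the kept letters, the restriction of `b ++ [c]` ends in `c`, so nothing
  -- kept can follow the last `c` of `p`. Taking `z = c` excludes letters of `L` from `w`; if `c ∈
  -- L`, every `z` is allowed and `w` is empty.
  have key : ∀ z, (z = c ∨ c ∈ L) → keep (insert z L) w = [] ∧
      keep (insert z L) a = keep (insert z L) b := by
    intro z hz
    have hcz : c ∈ insert z L := by
      rcases hz with rfl | hz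
      · simp
      · simp [hz]
    have := h z
    rw [keep_append, keep_append, keep_cons_of_mem hcz, keep_cons_of_mem hcz, keep_nil] at this
    have := append_cons_append_inj_last this (by simp [hw]) (by simp)
    exact this.symm
  refine ⟨a, w, rfl, hw, ?_, ?_, ?_⟩
  · intro z hz hzL
    exact keep_eq_nil.1 (key c (Or.inl rfl)).1 z hz (by simp [hzL])
  · intro hcL
    by_contra hne
    obtain ⟨z, hz⟩ := List.exists_mem_of_ne_nil w hne
    exact keep_eq_nil.1 (key z (Or.inr hcL)).1 z hz (by simp)
  · intro z
    by_cases hz : z = c ∨ c ∈ L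
    · rw [keep_append, (key z hz).1, (key z hz).2]; simp
    · have hcz : c ∉ insert z L := by
        rw [Finset.mem_insert]; tauto
      have := h z
      simpa [keep_cons_of_notMem hcz] using this

theorem Bal.eq_nil {L : Finset ℕ} {p : List ℕ} (h : Bal L p []) : p = [] := by
  by_contra hne
  obtain ⟨z, hz⟩ := List.exists_mem_of_ne_nil p hne
  simpa using (h.mem_iff z).1 hz

/-! ### Fully invariant congruences and the swaps given by `σ₁` and `σ_μ` -/

/-- Fully invariant congruences of the free monoid of lists of variables. -/
structure IsFI (R : List ℕ → List ℕ → Prop) : Prop where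
  equiv : Equivalence R
  append : ∀ {u v : List ℕ} (p q : List ℕ), R u v → R (p ++ u ++ q) (p ++ v ++ q)
  subst : ∀ {u v : List ℕ} (φ : ℕ → List ℕ), R u v → R (u.flatMap φ) (v.flatMap φ)

theorem IsFI.refl {R : List ℕ → List ℕ → Prop} (h : IsFI R) (u : List ℕ) : R u u := h.equiv.refl u

theorem IsFI.symm {R : List ℕ → List ℕ → Prop} (h : IsFI R) {u v : List ℕ} (huv : R u v) : R v u :=
  h.equiv.symm huv

theorem IsFI.trans {R : List ℕ → List ℕ → Prop} (h : IsFI R) {u v w : List ℕ} (huv : R u v)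
    (hvw : R v w) : R u w := h.equiv.trans huv hvw

theorem IsFI.keep {R : List ℕ → List ℕ → Prop} (h : IsFI R) {u v : List ℕ} (K : Finset ℕ)
    (huv : R u v) : R (keep K u) (keep K v) := by
  have := h.subst (fun x => if x ∈ K then [x] else []) huv
  rwa [← flatMap_keep, ← flatMap_keep, flatMap_id (by simp), flatMap_id (by simp)] at this

/-- A fully invariant congruence containing `σ₁` and `σ_μ`. -/
structure IsSigmaFI (R : List ℕ → List ℕ → Prop) : Prop extends IsFI R where
  sigmaOne : R [0, 1, 2, 0, 3, 1] [1, 0, 2, 0, 3, 1]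
  sigmaMu : R [0, 2, 0, 1, 3, 1] [0, 2, 1, 0, 3, 1]

variable {R : List ℕ → List ℕ → Prop}

theorem IsSigmaFI.sigmaOne' (h : IsSigmaFI R) (p q q' q'' : List ℕ) (x y : ℕ) :
    R (p ++ x :: y :: (q ++ x :: (q' ++ y :: q''))) (p ++ y :: x :: (q ++ x :: (q' ++ y :: q''))) := by
  have := h.append p q'' (h.subst (fun | 0 => [x] | 1 => [y] | 2 => q | _ => q') h.sigmaOne)
  simpa using this

theorem IsSigmaFI.sigmaMu' (h : IsSigmaFI R) (p p' q q' : List ℕ) (x y : ℕ) :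
    R (p ++ x :: (p' ++ x :: y :: (q ++ y :: q'))) (p ++ x :: (p' ++ y :: x :: (q ++ y :: q'))) := by
  have := h.append p q' (h.subst (fun | 0 => [x] | 1 => [y] | 2 => p' | _ => q) h.sigmaMu)
  simpa using this

/-- Adjacent occurrences of non-linear letters may be swapped unless both are last occurrences. -/
theorem IsSigmaFI.swap (h : IsSigmaFI R) {p q : List ℕ} {x y : ℕ} (hx : x ∈ p ++ q)
    (hy : y ∈ p ++ q) (hq : x ∈ q ∨ y ∈ q) : R (p ++ x :: y :: q) (p ++ y :: x :: q) := by
  by_cases hxy : x = y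
  · subst hxy; exact h.refl _
  have hmu : ∀ x y : ℕ, x ∈ p → y ∈ q → R (p ++ x :: y :: q) (p ++ y :: x :: q) := by
    intro x y hx' hy'
    obtain ⟨a, b, hab⟩ := List.append_of_mem hx'
    obtain ⟨c, d, hcd⟩ := List.append_of_mem hy'
    rw [hab, hcd]
    simpa using h.sigmaMu' a b c d x y
  -- Which of the two letters recurs first in `q` decides the roles in `σ₁` and the direction in
  -- which it is used.
  have hone : ∀ x y : ℕ, x ≠ y → x ∈ q → y ∈ q → R (p ++ x :: y :: q) (p ++ y :: x :: q) := by
    intro x y hxy hx' hy'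
    obtain ⟨a, b, hab⟩ := List.append_of_mem hx'
    rw [hab] at hy' ⊢
    rcases List.mem_append.1 hy' with hy' | hy'
    · obtain ⟨c, d, rfl⟩ := List.append_of_mem hy'
      simpa using h.symm (h.sigmaOne' p c d b y x)
    · obtain ⟨c, d, rfl⟩ := List.append_of_mem (List.mem_of_ne_of_mem (Ne.symm hxy) hy')
      simpa using h.sigmaOne' p a c d x y
  rw [List.mem_append] at hx hy
  by_cases hxq : x ∈ q
  · by_cases hyq : y ∈ q
    · exact hone x y hxy hxq hyq
    · exact h.symm (hmu y x (by tauto) hxq)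
  · exact hmu x y (by tauto) (by tauto)

theorem IsSigmaFI.move_right (h : IsSigmaFI R) {p w s : List ℕ} {x : ℕ} (hx : x ∈ p ++ s)
    (hw : ∀ y ∈ w, 2 ≤ (p ++ w ++ s).count y ∧ (x ∈ s ∨ y ∈ s)) :
    R (p ++ x :: (w ++ s)) (p ++ w ++ x :: s) := by
  induction w generalizing p with
  | nil => simpa using h.refl _
  | cons y w ih =>
    have hy := hw y (by simp)
    have h1 : R (p ++ x :: y :: (w ++ s)) (p ++ y :: x :: (w ++ s)) := by
      apply h.swap
      · simp at hx ⊢; tauto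
      · have := hy.1
        have h0 : 0 < (p ++ (w ++ s)).count y := by
          simp only [List.count_append, List.count_cons_self] at this ⊢; omega
        exact List.count_pos_iff.1 h0
      · simp; tauto
    refine h.trans h1 ?_
    have := ih (p := p ++ [y]) (by simp at hx ⊢; tauto) (by
      intro z hz
      have := hw z (by simp [hz])
      simpa using this)
    simpa using this

/-- Balanced words are equivalent in a context in which no last occurrences are moved. -/
theorem IsSigmaFI.of_bal (h : IsSigmaFI R) {L : Finset ℕ} {a b s : List ℕ} (hab : Bal L a b)
    (hs : ∀ z ∈ a, z ∉ L → z ∈ s) : R (a ++ s) (b ++ s) := by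
  induction b using List.reverseRecOn generalizing a s with
  | nil => rw [hab.eq_nil]; exact h.refl _
  | append_singleton b c ih =>
    obtain ⟨a, w, rfl, hcw, hwL, hcL, hb⟩ := hab.exists_split
    -- The target is built from its right end: the last `c` travels to the end of the prefix. It
    -- never meets an obstruction, because a non-linear `c` recurs in `s`.
    have h1 : R (a ++ c :: (w ++ s)) (a ++ w ++ c :: s) := by
      by_cases hc : c ∈ L
      · rw [hcL hc]; simpa using h.refl _
      · have hcs := hs c (by simp) hc
        apply h.move_right (by simp [hcs])
        intro y hy
        have hys := hs y (by simp [hy]) (hwL y hy)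
        refine ⟨?_, Or.inl hcs⟩
        have h1 := List.count_pos_iff.2 hy
        have h2 := List.count_pos_iff.2 hys
        simp only [List.count_append]
        omega
    have h2 := ih (a := a ++ w) (s := c :: s) hb (by
      intro z hz hzL
      have := hs z (by simp at hz ⊢; tauto) hzL
      simp [this])
    have := h.trans h1 h2
    simpa using this

/-! ### Applying an almost-linear identity inside a longer word -/

/-- The letters of `X` can be collected right after the preceding letter of `L`, which
exhibits a word as a substitution instance of its restriction to `X ∪ L`. -/
theorem exists_collect (X L : Finset ℕ) (hXL : Disjoint X L) (p : List ℕ)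
    (hL : ∀ t ∈ L, p.count t ≤ 1) :
    ∃ (P : List ℕ) (φ : ℕ → List ℕ), (∀ x ∈ X, φ x = [x]) ∧ (∀ c ∈ P, c ∉ X ∪ L) ∧
      (∀ t ∈ L, keep (X ∪ L) (φ t) = [t]) ∧
      p.Perm (P ++ (keep (X ∪ L) p).flatMap φ) ∧
      (∀ K, Disjoint X K → keep K p = keep K (P ++ (keep (X ∪ L) p).flatMap φ)) ∧
      ∀ R, IsSigmaFI R → ∀ p0 s : List ℕ, (∀ x ∈ X, x ∈ s) →
        (∀ c ∈ p, c ∉ L → 2 ≤ (p0 ++ (p ++ s)).count c) →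
        R (p0 ++ (p ++ s)) (p0 ++ (P ++ (keep (X ∪ L) p).flatMap φ ++ s)) := by
  induction p with
  | nil =>
    refine ⟨[], fun x => [x], by simp, by simp, ?_, by simp, by simp, ?_⟩
    · intro t ht; simp [keep, ht]
    · intro R hR p0 s _ _; simpa using hR.refl _
  | cons c p ih =>
    have hL' : ∀ t ∈ L, p.count t ≤ 1 := fun t ht =>
      (List.count_le_count_cons).trans (hL t ht)
    obtain ⟨P, φ, hφX, hP, hφL, hperm, hkeep, hR⟩ := ih hL'
    have hcount : ∀ (p0 s : List ℕ), (∀ d ∈ c :: p, d ∉ L → 2 ≤ (p0 ++ (c :: p ++ s)).count d) →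
        ∀ d ∈ p, d ∉ L → 2 ≤ ((p0 ++ [c]) ++ (p ++ s)).count d := by
      intro p0 s h d hd hdL
      have := h d (by simp [hd]) hdL
      simpa using this
    by_cases hcX : c ∈ X
    · have hcL : c ∉ L := Finset.disjoint_left.1 hXL hcX
      have hc : c ∈ X ∪ L := by simp [hcX]
      refine ⟨P, φ, hφX, hP, hφL, ?_, ?_, ?_⟩
      · rw [keep_cons_of_mem hc, List.flatMap_cons, hφX c hcX]
        exact (hperm.cons c).trans (by simpa using List.perm_middle.symm)
      · intro K hK
        have hcK : c ∉ K := Finset.disjoint_left.1 hK hcX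
        rw [keep_cons_of_mem hc, List.flatMap_cons, hφX c hcX, keep_cons_of_notMem hcK,
          hkeep K hK]
        simp [keep_cons_of_notMem hcK]
      · intro R hR' p0 s hs hc2
        have h1 := hR R hR' (p0 ++ [c]) s hs (hcount p0 s hc2)
        rw [keep_cons_of_mem hc, List.flatMap_cons, hφX c hcX]
        set F := (keep (X ∪ L) p).flatMap φ
        -- The letter `c` of `X` jumps over the block `P` of foreign letters. This is legal since
        -- `c` recurs in `s` and every letter of `P` is non-linear in the whole word.
        have h2 : R (p0 ++ c :: (P ++ (F ++ s))) (p0 ++ P ++ c :: (F ++ s)) := by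
          apply hR'.move_right
          · simp [hs c hcX]
          · intro y hy
            refine ⟨?_, Or.inl (by simp [hs c hcX])⟩
            have hy' := hP y hy
            simp only [Finset.mem_union, not_or] at hy'
            have := hcount p0 s hc2 y (hperm.mem_iff.2 (by simp [hy])) hy'.2
            have hyc : c ≠ y := fun h => hy'.1 (h ▸ hcX)
            have hpc := hperm.count_eq y
            simp only [List.count_append, List.count_cons_of_ne hyc, List.count_nil] at this hpc ⊢
            omega
        have := hR'.trans (by simpa using h1) h2
        simpa using this
    by_cases hcL : c ∈ L
    · have hc : c ∈ X ∪ L := by simp [hcL]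
      have hcp : c ∉ p := by
        have := hL c hcL
        rw [List.count_cons_self] at this
        rw [← List.count_pos_iff]; omega
      have hF : (keep (X ∪ L) (c :: p)).flatMap (Function.update φ c (c :: P)) =
          c :: (P ++ (keep (X ∪ L) p).flatMap φ) := by
        rw [keep_cons_of_mem hc, List.flatMap_cons, Function.update_self]
        rw [flatMap_congr_mem (ψ := φ)]
        · simp
        · intro x hx
          rw [Function.update_of_ne]
          rintro rfl
          exact hcp (mem_keep.1 hx).1
      refine ⟨[], Function.update φ c (c :: P), ?_, by simp, ?_, ?_, ?_, ?_⟩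
      · intro x hx
        rw [Function.update_of_ne, hφX x hx]
        rintro rfl; exact hcX hx
      · intro t ht
        by_cases htc : t = c
        · subst htc
          rw [Function.update_self, keep_cons_of_mem hc, keep_eq_nil.2 hP]
        · rw [Function.update_of_ne htc, hφL t ht]
      · rw [hF]; exact hperm.cons c
      · intro K hK
        rw [hF]
        have := hkeep K hK
        by_cases hcK : c ∈ K
        · simpa [keep_cons_of_mem hcK] using this
        · simpa [keep_cons_of_notMem hcK] using this
      · intro R hR' p0 s hs hc2
        have h1 := hR R hR' (p0 ++ [c]) s hs (hcount p0 s hc2)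
        rw [hF]
        simpa using h1
    · have hc : c ∉ X ∪ L := by simp [hcX, hcL]
      refine ⟨c :: P, φ, hφX, ?_, hφL, ?_, ?_, ?_⟩
      · intro d hd
        rcases List.mem_cons.1 hd with rfl | hd
        · exact hc
        · exact hP d hd
      · rw [keep_cons_of_notMem hc]; exact hperm.cons c
      · intro K hK
        rw [keep_cons_of_notMem hc]
        have := hkeep K hK
        by_cases hcK : c ∈ K
        · simpa [keep_cons_of_mem hcK] using this
        · simpa [keep_cons_of_notMem hcK] using this
      · intro R hR' p0 s hs hc2
        have h1 := hR R hR' (p0 ++ [c]) s hs (hcount p0 s hc2)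
        rw [keep_cons_of_notMem hc]
        simpa using h1

/-- Meant for the part of a word after the last occurrence of the distinguished letter, where
nothing has to be moved: foreign letters are absorbed into the next letter of `L`, and `Q` is what
follows the last one. Absorbing forwards rather than backwards avoids attaching anything to the
distinguished letter. -/
theorem exists_collect_tail (L : Finset ℕ) (q : List ℕ) (hL : ∀ t ∈ L, q.count t ≤ 1) :
    ∃ (Q : List ℕ) (ψ : ℕ → List ℕ), (∀ c ∈ Q, c ∈ q ∧ c ∉ L) ∧
      (∀ t ∈ L, keep L (ψ t) = [t] ∧ ∀ c ∈ ψ t, c = t ∨ c ∈ q) ∧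
      (keep L q).flatMap ψ ++ Q = q := by
  induction q using List.reverseRecOn with
  | nil =>
    refine ⟨[], fun x => [x], by simp, ?_, by simp⟩
    intro t ht; simp [keep, ht]
  | append_singleton q c ih =>
    obtain ⟨Q, ψ, hQ, hψ, heq⟩ := ih fun t ht => by
      have := hL t ht
      rw [List.count_append] at this; omega
    by_cases hc : c ∈ L
    · have hcq : c ∉ q := by
        have := hL c hc
        rw [List.count_append, List.count_cons_self] at this
        rw [← List.count_pos_iff]; omega
      refine ⟨[], Function.update ψ c (Q ++ [c]), by simp, ?_, ?_⟩
      · intro t ht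
        by_cases htc : t = c
        · subst htc
          rw [Function.update_self, keep_append, keep_cons_of_mem hc,
            keep_eq_nil.2 fun x hx => (hQ x hx).2]
          refine ⟨rfl, ?_⟩
          intro d hd
          simp only [List.mem_append, List.mem_singleton] at hd ⊢
          rcases hd with hd | hd
          · exact Or.inr (Or.inl (hQ d hd).1)
          · exact Or.inl hd
        · rw [Function.update_of_ne htc]
          refine ⟨(hψ t ht).1, fun d hd => ?_⟩
          have := (hψ t ht).2 d hd
          simp; tauto
      · rw [keep_append, keep_cons_of_mem hc, keep_nil, List.flatMap_append,
          flatMap_congr_mem (ψ := ψ)]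
        · simp only [List.flatMap_cons, List.flatMap_nil, Function.update_self, List.append_nil]
          rw [← List.append_assoc, heq]
        · intro x hx
          rw [Function.update_of_ne]
          rintro rfl
          exact hcq (mem_keep.1 hx).1
    · refine ⟨Q ++ [c], ψ, ?_, ?_, ?_⟩
      · intro d hd
        simp only [List.mem_append, List.mem_singleton] at hd ⊢
        rcases hd with hd | rfl
        · exact ⟨Or.inl (hQ d hd).1, (hQ d hd).2⟩
        · exact ⟨Or.inr rfl, hc⟩
      · intro t ht
        refine ⟨(hψ t ht).1, fun d hd => ?_⟩
        have := (hψ t ht).2 d hd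
        simp; tauto
      · rw [keep_append, keep_cons_of_notMem hc]
        simp only [keep_nil, List.append_nil]
        rw [← List.append_assoc, heq]

/-- An identity in one non-linear letter `x` and the linear letters `L` of a word can be applied to
this word, changing only the occurrences of `x`. -/
theorem IsSigmaFI.exists_apply_almostLinear (h : IsSigmaFI R) {L : Finset ℕ} {x : ℕ} {u β : List ℕ}
    (hx : x ∉ L) (hxu : x ∈ u) (hL : ∀ t ∈ L, u.count t = 1)
    (hu : ∀ c ∈ u, c ∉ L → 2 ≤ u.count c)
    (hβ : R (keep (insert x L) u) β) (hβ' : ∀ c ∈ β, c ∈ insert x L)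
    (hβL : keep L β = keep L u) :
    ∃ v, R u v ∧ keep (insert x L) v = β ∧
      ∀ z, z ≠ x → keep (insert z L) v = keep (insert z L) u := by
  obtain ⟨p, q, rfl, hxq⟩ := exists_eq_append_cons_last hxu
  have hXL : Disjoint {x} L := by simpa using hx
  obtain ⟨P, φ, hφX, hP, hφL, hperm, hkeep, hR⟩ := exists_collect {x} L hXL p fun t ht => by
    have := hL t ht
    rw [List.count_append] at this; omega
  obtain ⟨Q, ψ, hQ, hψ, hq⟩ := exists_collect_tail L q fun t ht => by
    have := hL t ht
    rw [List.count_append, List.count_cons] at this; omega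
  have hins : ({x} : Finset ℕ) ∪ L = insert x L := rfl
  simp only [hins] at hP hφL hkeep hR
  -- Letters of `L` occur once in `u`, so each lies on one side of the last `x` only, and the two
  -- substitutions can be glued.
  set Φ : ℕ → List ℕ := fun t => if t = x ∨ t ∈ p then φ t else ψ t with hΦ
  have hΦx : Φ x = [x] := by simp [hΦ, hφX]
  have hΦp : (keep (insert x L) p).flatMap Φ = (keep (insert x L) p).flatMap φ :=
    flatMap_congr_mem fun c hc => by simp [hΦ, (mem_keep.1 hc).1]
  have hΦq : (keep (insert x L) q).flatMap Φ = (keep L q).flatMap ψ := by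
    have : keep (insert x L) q = keep L q := keep_congr fun c hc => by
      have : c ≠ x := fun h => hxq (h ▸ hc)
      simp [this]
    rw [this]
    refine flatMap_congr_mem fun c hc => ?_
    have hc' := mem_keep.1 hc
    have h1 : c ≠ x := fun h => hxq (h ▸ hc'.1)
    have h2 : c ∉ p := by
      intro hcp
      have := hL c hc'.2
      have h3 := List.count_pos_iff.2 hcp
      have h4 := List.count_pos_iff.2 hc'.1
      simp only [List.count_append, List.count_cons] at this
      omega
    simp [hΦ, h1, h2]
  have hxx : x ∈ insert x L := by simp
  have hα : P ++ (keep (insert x L) (p ++ x :: q)).flatMap Φ ++ Q =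
      [] ++ (P ++ (keep (insert x L) p).flatMap φ ++ x :: q) := by
    rw [keep_append, keep_cons_of_mem hxx, List.flatMap_append, List.flatMap_cons, hΦp, hΦq, hΦx]
    conv_rhs => rw [← hq]
    simp
  have hΦL : ∀ t ∈ insert x L, keep (insert x L) (Φ t) = [t] := by
    intro t ht
    rcases Finset.mem_insert.1 ht with rfl | ht'
    · rw [hΦx, keep_cons_of_mem hxx]; rfl
    · by_cases htp : t = x ∨ t ∈ p
      · simp only [hΦ, htp, if_true]; exact hφL t ht'
      · simp only [hΦ, htp, if_false]
        rw [← (hψ t ht').1]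
        refine keep_congr fun c hc => ?_
        have : c ≠ x := by
          rintro rfl
          rcases (hψ t ht').2 c hc with h | h
          · exact htp (Or.inl h.symm)
          · exact hxq h
        simp [this]
  refine ⟨P ++ β.flatMap Φ ++ Q, ?_, ?_, ?_⟩
  · have h1 := h.append P Q (h.subst Φ hβ)
    rw [hα] at h1
    refine h.trans ?_ h1
    have := hR R h [] (x :: q) (by simp) (by
      intro c hc hcL
      exact hu c (by simp [hc]) hcL)
    simpa using this
  · have hQx : keep (insert x L) Q = [] := keep_eq_nil.2 fun c hc => by
      have := hQ c hc
      have h1 : c ≠ x := fun h => hxq (h ▸ this.1)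
      simp [h1, this.2]
    rw [keep_append, keep_append, keep_eq_nil.2 hP, hQx, keep_flatMap,
      flatMap_id fun c hc => hΦL c (hβ' c hc)]
    simp
  · intro z hz
    have hxz : x ∉ insert z L := by
      rw [Finset.mem_insert]; rintro (h | h)
      · exact hz h.symm
      · exact hx h
    have key : ∀ γ : List ℕ, (∀ c ∈ γ, c ∈ insert x L) → keep (insert z L) (γ.flatMap Φ) =
        (keep L γ).flatMap fun c => keep (insert z L) (Φ c) := by
      intro γ hγ
      rw [keep_flatMap, flatMap_keep]
      refine flatMap_congr_mem fun c hc => ?_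
      rcases Finset.mem_insert.1 (hγ c hc) with rfl | hcL
      · rw [if_neg hx, hΦx, keep_cons_of_notMem hxz, keep_nil]
      · rw [if_pos hcL]
    have h1 : keep (insert z L) (p ++ x :: q) =
        keep (insert z L) (P ++ (keep (insert x L) (p ++ x :: q)).flatMap Φ ++ Q) := by
      rw [hα, List.nil_append, keep_append, keep_append,
        hkeep (insert z L) (Finset.disjoint_singleton_left.2 hxz)]
    rw [h1, keep_append, keep_append, keep_append, keep_append, key β hβ',
      key _ (fun c hc => (mem_keep.1 hc).2), hβL,
      keep_keep]
    rw [Finset.inter_eq_left.2 (Finset.subset_insert x L)]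

/-! ### Balanced identities from swaps of two last occurrences -/

theorem keep_eq_of_subset {A M : Finset ℕ} (h : A ⊆ M) {u v : List ℕ} (huv : keep M u = keep M v) :
    keep A u = keep A v := by
  have := congrArg (keep A) huv
  rwa [keep_keep, keep_keep, Finset.inter_eq_left.2 h] at this

/-- `R` contains every identity of `T` that swaps the last occurrences of the only two non-linear
letters of a word. -/
def HasSwaps (R T : List ℕ → List ℕ → Prop) : Prop :=
  ∀ (L : Finset ℕ) (p : List ℕ) (c y : ℕ), c ≠ y → c ∉ L → y ∉ L → c ∈ p → y ∈ p →
    (∀ t ∈ L, p.count t ≤ 1) → (∀ z ∈ p, z = c ∨ z = y ∨ z ∈ L) →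
    T (p ++ [c, y]) (p ++ [y, c]) → R (p ++ [c, y]) (p ++ [y, c])

variable {T : List ℕ → List ℕ → Prop}

/-- Restricting the given identity of `T` to `c`, `y` and the letters of `L` in `p` leaves a word
ending in `c y` on the left, and on the right one that `T` turns into the same prefix followed by `y
c`. So `T` contains a swap with only two non-linear letters, hence so does `R`. Collecting `c` and
`y` inside `p` makes the long word a substitution instance of the short one, in a context. -/
theorem IsSigmaFI.swap_last (hR : IsSigmaFI R) (hT : IsSigmaFI T) (hsw : HasSwaps R T)
    {L : Finset ℕ} {p w b s : List ℕ} {c y : ℕ} (hcy : c ≠ y) (hcL : c ∉ L) (hyL : y ∉ L)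
    (hcp : c ∈ p) (hyp : y ∈ p) (hcw : c ∉ w) (hyw : y ∉ w) (hcs : c ∉ s) (hys : y ∉ s)
    (hL : ∀ t ∈ L, (p ++ (w ++ s)).count t ≤ 1)
    (hp : ∀ z ∈ p, z ∉ L → 2 ≤ (p ++ c :: y :: (w ++ s)).count z)
    (hc : keep (insert c L) p = keep (insert c L) b)
    (hy : keep (insert y L) (p ++ [y]) = keep (insert y L) b)
    (h : T (p ++ c :: y :: (w ++ s)) (b ++ c :: s)) :
    R (p ++ c :: y :: (w ++ s)) (p ++ y :: c :: (w ++ s)) := by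
  -- Letters of `L` beyond the swap are dropped, so that the restrictions of `w` and `s` to `K`
  -- vanish.
  set L1 := L.filter (· ∈ p) with hL1
  set K := insert c (insert y L1) with hK
  have hcK : c ∈ K := by simp [hK]
  have hyK : y ∈ K := by simp [hK]
  have hL1ws : ∀ t ∈ L1, t ∉ w ∧ t ∉ s := by
    intro t ht
    rw [hL1, Finset.mem_filter] at ht
    have h1 := hL t ht.1
    have h2 := List.count_pos_iff.2 ht.2
    simp only [List.count_append] at h1
    constructor <;> rw [← List.count_pos_iff] <;> omega
  have hKw : keep K w = [] := keep_eq_nil.2 fun t ht => by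
    rw [hK, Finset.mem_insert, Finset.mem_insert]
    rintro (rfl | rfl | h)
    · exact hcw ht
    · exact hyw ht
    · exact (hL1ws t h).1 ht
  have hKs : keep K s = [] := keep_eq_nil.2 fun t ht => by
    rw [hK, Finset.mem_insert, Finset.mem_insert]
    rintro (rfl | rfl | h)
    · exact hcs ht
    · exact hys ht
    · exact (hL1ws t h).2 ht
  have hTK : T (keep K p ++ [c, y]) (keep K b ++ [c]) := by
    have := hT.keep K h
    simpa [keep_cons_of_mem hcK, keep_cons_of_mem hyK, hKw, hKs] using this
  have hyM : y ∈ insert y L := by simp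
  have hyb : y ∈ b := by
    have : y ∈ keep (insert y L) (p ++ [y]) := by simp
    rw [hy] at this
    exact (mem_keep.1 this).1
  obtain ⟨r, r', rfl, hyr'⟩ := exists_eq_append_cons_last hyb
  have hsplit : keep (insert y L) p = keep (insert y L) r ∧ [] = keep (insert y L) r' := by
    rw [keep_append, keep_append, keep_cons_of_mem hyM, keep_cons_of_mem hyM, keep_nil] at hy
    exact append_cons_append_inj_last hy (by simp) (by simp [hyr'])
  have hyr : y ∈ r := by
    have : y ∈ keep (insert y L) p := by simp [hyp]
    rw [hsplit.1] at this
    exact (mem_keep.1 this).1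
  have hr' : ∀ z ∈ keep K r', z = c := by
    intro z hz
    have h1 := mem_keep.1 hz
    have h2 := keep_eq_nil.1 hsplit.2.symm z h1.1
    rw [Finset.mem_insert, not_or] at h2
    have h3 := h1.2
    rw [hK, Finset.mem_insert, Finset.mem_insert, hL1, Finset.mem_filter] at h3
    tauto
  -- Within `K`, only copies of `c` follow the last `y` of `b`. None of them is the last `c` of the
  -- word, so `y` may pass them.
  have hmove : T (keep K (r ++ y :: r') ++ [c]) (keep K (r ++ r') ++ [y, c]) := by
    have := hT.move_right (p := keep K r) (w := keep K r') (s := [c]) (x := y)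
      (by simp [hyr, hyK]) (by
        intro z hz
        have hz' := hr' z hz
        subst hz'
        have := List.count_pos_iff.2 hz
        refine ⟨?_, by simp⟩
        simp only [List.count_append, List.count_cons_self, List.count_nil]
        omega)
    simpa [keep_cons_of_mem hyK] using this
  have hkc : keep (insert c L) (r ++ r') = keep (insert c L) p := by
    have : y ∉ insert c L := by
      rw [Finset.mem_insert]; rintro (h | h)
      · exact hcy h.symm
      · exact hyL h
    rw [hc, keep_append, keep_append, keep_cons_of_notMem this]
  have hky : keep (insert y L) (r ++ r') = keep (insert y L) p := by
    rw [keep_append, ← hsplit.2, hsplit.1]; simp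
  have hbal : Bal L (keep K (r ++ r')) (keep K p) := by
    intro z
    rw [keep_keep, keep_keep]
    by_cases hz : z = y
    · subst hz
      exact keep_eq_of_subset Finset.inter_subset_left hky
    · refine keep_eq_of_subset ?_ hkc
      intro t ht
      rw [Finset.mem_inter, Finset.mem_insert, hK, Finset.mem_insert, Finset.mem_insert, hL1,
        Finset.mem_filter] at ht
      rw [Finset.mem_insert]
      rcases ht with ⟨rfl | h1, h2⟩ <;> tauto
  have hTsw : T (keep K p ++ [c, y]) (keep K p ++ [y, c]) := by
    refine hT.trans hTK (hT.trans hmove (hT.of_bal hbal ?_))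
    intro z hz hzL
    have := (mem_keep.1 hz).2
    rw [hK, Finset.mem_insert, Finset.mem_insert, hL1, Finset.mem_filter] at this
    simp only [List.mem_cons]
    tauto
  have hsw' := hsw L1 (keep K p) c y hcy (by simp [hL1, hcL]) (by simp [hL1, hyL])
    (by simp [hcp, hcK]) (by simp [hyp, hyK]) (by
      intro t ht
      rw [count_keep (by simp [hK, ht])]
      have := hL t (Finset.mem_filter.1 ht).1
      rw [List.count_append] at this; omega) (by
      intro z hz
      simpa [hK] using (mem_keep.1 hz).2) hTsw
  have hXL : Disjoint {c, y} L := by simp [hcL, hyL]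
  obtain ⟨P, φ, hφX, -, -, -, -, hcol⟩ := exists_collect {c, y} L hXL p fun t ht => by
    have := hL t ht
    rw [List.count_append] at this; omega
  have hKp : keep ({c, y} ∪ L) p = keep K p := keep_congr fun x hx => by
    simp [hK, hL1, hx]
  rw [hKp] at hcol
  have hφc := hφX c (by simp)
  have hφy := hφX y (by simp)
  have h1 := hcol R hR [] (c :: y :: (w ++ s)) (by simp) hp
  have h2 := hcol R hR [] (y :: c :: (w ++ s)) (by simp) (by
    intro z hz hzL
    have := hp z hz hzL
    simp only [List.nil_append]
    simp only [List.count_append, List.count_cons] at this ⊢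
    omega)
  have h3 := hR.append P (w ++ s) (hR.subst φ hsw')
  simp only [List.flatMap_append, List.flatMap_cons, List.flatMap_nil, hφc, hφy] at h3
  simp only [List.nil_append, List.append_assoc, List.cons_append] at h1 h2 h3
  exact hR.trans h1 (hR.trans h3 (hR.symm h2))

/-- Balanced identities follow from those swapping two last occurrences. -/
theorem IsSigmaFI.of_bal_of_hasSwaps (hR : IsSigmaFI R) (hT : IsSigmaFI T)
    (hRT : ∀ u v, R u v → T u v) (hsw : HasSwaps R T) {L : Finset ℕ} {a b s : List ℕ}
    (hab : Bal L a b) (hL : ∀ t ∈ L, (a ++ s).count t ≤ 1)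
    (ha : ∀ z ∈ a, z ∉ L → 2 ≤ (a ++ s).count z) (h : T (a ++ s) (b ++ s)) :
    R (a ++ s) (b ++ s) := by
  induction b using List.reverseRecOn generalizing a s with
  | nil => rw [hab.eq_nil]; exact hR.refl _
  | append_singleton b c ih =>
    obtain ⟨a, w, rfl, hcw, hwL, hcL, hb⟩ := hab.exists_split
    have hcount : ∀ z, (a ++ w ++ c :: s).count z = (a ++ c :: w ++ s).count z := by
      intro z
      simp only [List.count_append, List.count_cons]; omega
    have h1 : R (a ++ c :: (w ++ s)) (a ++ w ++ c :: s) := by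
      by_cases hc : c ∈ L
      · rw [hcL hc]; simpa using hR.refl _
      by_cases hcs : c ∈ s
      · apply hR.move_right (by simp [hcs])
        intro y hy
        refine ⟨?_, Or.inl hcs⟩
        have := ha y (by simp [hy]) (hwL y hy)
        have hyc : c ≠ y := fun h => hcw (h ▸ hy)
        simpa [List.count_cons_of_ne hyc] using this
      have hca : c ∈ a := by
        have := ha c (by simp) hc
        rw [← List.count_eq_zero] at hcw hcs
        simp only [List.count_append, List.count_cons_self] at this
        rw [← List.count_pos_iff]; omega
      -- The letter `c` moves one place at a time. The `T`-equality with the target is carried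
      -- along, since `swap_last` needs it whenever `c` and its neighbour are both last occurrences.
      have inner : ∀ w2 w1 : List ℕ, w = w1 ++ w2 → T (a ++ w1 ++ c :: (w2 ++ s)) (b ++ c :: s) →
          R (a ++ w1 ++ c :: (w2 ++ s)) (a ++ w ++ c :: s) := by
        intro w2
        induction w2 with
        | nil => rintro w1 rfl _; simpa using hR.refl _
        | cons y w2 ih2 =>
          rintro w1 hw hTw
          have hyw : y ∈ w := by simp [hw]
          have hcy : c ≠ y := fun h => hcw (h ▸ hyw)
          have hyL := hwL y hyw
          have hy2 := ha y (by simp [hyw]) hyL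
          have hcount2 : ∀ z, (a ++ w1 ++ c :: y :: (w2 ++ s)).count z =
              (a ++ c :: w ++ s).count z := by
            intro z
            simp only [hw, List.count_append, List.count_cons]; omega
          have hstep : R (a ++ w1 ++ c :: y :: (w2 ++ s)) (a ++ w1 ++ y :: c :: (w2 ++ s)) := by
            have hyp : y ∈ a ++ w1 ++ (w2 ++ s) := by
              rw [← hcount2] at hy2
              rw [← List.count_pos_iff]
              simp only [List.count_append, List.count_cons_self,
                List.count_cons_of_ne hcy] at hy2 ⊢
              omega
            by_cases hyq : y ∈ w2 ++ s
            · exact hR.swap (by simp [hca]) hyp (Or.inr hyq)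
            · have hyq' : y ∉ w2 ∧ y ∉ s := by simpa using hyq
              have hcw2 : c ∉ w2 := fun h => hcw (by simp [hw, h])
              refine hR.swap_last hT hsw hcy hc hyL (by simp [hca])
                (by rw [List.mem_append] at hyp; tauto)
                hcw2 hyq'.1 hcs hyq'.2 ?_ ?_ ?_ ?_ hTw
              · intro t ht
                have := hL t ht
                rw [← hcount2] at this
                simp only [List.count_append, List.count_cons] at this ⊢
                omega
              · intro z hz hzL
                rw [hcount2]
                refine ha z ?_ hzL
                simp [hw] at hz ⊢; tauto
              · have := hb c
                rw [hw] at this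
                rw [← this]
                simp only [keep_append]
                rw [keep_cons_of_notMem (by simp [hcy.symm, hyL]) w2,
                  (keep_eq_nil (l := w2)).2 (fun z hz => ?_)]
                · simp
                · have : z ≠ c := fun h => hcw2 (h ▸ hz)
                  simp [this, hwL z (by simp [hw, hz])]
              · have := hb y
                rw [hw] at this
                rw [← this]
                simp only [keep_append]
                rw [keep_cons_of_mem (by simp) w2, keep_cons_of_mem (by simp) [],
                  (keep_eq_nil (l := w2)).2 (fun z hz => ?_)]
                · simp
                · have : z ≠ y := fun h => hyq'.1 (h ▸ hz)
                  simp [this, hwL z (by simp [hw, hz])]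
          have := ih2 (w1 ++ [y]) (by simp [hw]) (by
            have := hT.trans (hT.symm (hRT _ _ hstep)) hTw
            simpa using this)
          exact hR.trans hstep (by simpa using this)
      have := inner w [] rfl (by simpa using h)
      simpa using this
    have h2 := ih (a := a ++ w) (s := c :: s) hb (by
      intro t ht; rw [hcount]; exact hL t ht) (by
      intro z hz hzL
      rw [hcount]
      exact ha z (by simp at hz ⊢; tauto) hzL) (by
      have := hT.trans (hT.symm (hRT _ _ h1)) (by simpa using h)
      simpa using this)
    have := hR.trans h1 h2
    simpa using this

/-! ### Reduction of an arbitrary identity to the two special kinds -/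

/-- `R` contains every identity of `T` over one letter `x` and linear letters in the same order. -/
def HasAlmostLinear (R T : List ℕ → List ℕ → Prop) : Prop :=
  ∀ (L : Finset ℕ) (x : ℕ) (α β : List ℕ), x ∉ L → (∀ t ∈ L, α.count t ≤ 1) →
    (∀ z ∈ α, z ∈ insert x L) → (∀ z ∈ β, z ∈ insert x L) → keep L α = keep L β →
    T α β → R α β

theorem IsSigmaFI.of_keep_eq (hR : IsSigmaFI R) (hT : IsSigmaFI T)
    (hRT : ∀ u v, R u v → T u v) (hal : HasAlmostLinear R T) (hsw : HasSwaps R T) {L : Finset ℕ}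
    {u v : List ℕ} (h : T u v) (hmem : ∀ x, x ∈ u ↔ x ∈ v) (hLu : ∀ t ∈ L, u.count t = 1)
    (hu : ∀ z ∈ u, z ∉ L → 2 ≤ u.count z) (hv : ∀ z ∈ v, z ∉ L → 2 ≤ v.count z)
    (hLL : keep L u = keep L v) : R u v := by
  -- The non-linear letters are corrected one at a time: relative to `L`, those in `Z` already sit
  -- as in `v`, the others still as in `u`.
  have main : ∀ Z : Finset ℕ, (∀ z ∈ Z, z ∈ u ∧ z ∉ L) → ∃ u', R u u' ∧
      ∀ z, keep (insert z L) u' = keep (insert z L) (if z ∈ Z then v else u) := by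
    intro Z
    induction Z using Finset.induction_on with
    | empty => exact fun _ => ⟨u, hR.refl u, fun z => by simp⟩
    | insert x Z hxZ ih =>
      intro hZ
      obtain ⟨u', huu', hu'⟩ := ih fun z hz => hZ z (by simp [hz])
      obtain ⟨hxu, hxL⟩ := hZ x (by simp)
      have hcount : ∀ z, u'.count z = (if z ∈ Z then v else u).count z := fun z => by
        rw [← count_keep (Finset.mem_insert_self z L), hu' z,
          count_keep (Finset.mem_insert_self z L)]
      have hLu' : ∀ t ∈ L, u'.count t = 1 := by
        intro t ht
        have : t ∉ Z := fun h => (hZ t (by simp [h])).2 ht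
        rw [hcount, if_neg this, hLu t ht]
      have hTu' : T u' v := hT.trans (hT.symm (hRT _ _ huu')) h
      have hkL : keep L u' = keep L v := by
        rw [← hLL]
        refine keep_eq_of_subset (Finset.subset_insert x L) ?_
        rw [hu' x, if_neg hxZ]
      have hR1 : R (keep (insert x L) u') (keep (insert x L) v) := by
        refine hal L x _ _ hxL ?_ (fun z hz => (mem_keep.1 hz).2) (fun z hz => (mem_keep.1 hz).2)
          ?_ (hT.keep _ hTu')
        · intro t ht
          rw [count_keep (by simp [ht]), hLu' t ht]
        · rw [keep_keep, keep_keep, Finset.inter_eq_left.2 (Finset.subset_insert x L), hkL]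
      obtain ⟨w, huw, hwx, hwz⟩ := hR.exists_apply_almostLinear hxL (u := u') (by
          rw [← List.count_pos_iff, hcount, if_neg hxZ, List.count_pos_iff]; exact hxu)
        hLu' (by
          intro c hc hcL
          rw [← List.count_pos_iff, hcount] at hc
          rw [hcount]
          split_ifs at hc ⊢
          · exact hv c (List.count_pos_iff.1 hc) hcL
          · exact hu c (List.count_pos_iff.1 hc) hcL) hR1
        (fun c hc => (mem_keep.1 hc).2) (by
          rw [keep_keep, Finset.inter_eq_left.2 (Finset.subset_insert x L), hkL])
      refine ⟨w, hR.trans huu' huw, fun z => ?_⟩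
      by_cases hzx : z = x
      · subst hzx; rw [hwx]; simp
      · rw [hwz z hzx, hu' z]; simp [hzx]
  obtain ⟨u', huu', hu'⟩ := main (u.toFinset \ L) (by simp)
  have hbal : Bal L u' v := by
    intro z
    rw [hu' z]
    by_cases hzL : z ∈ L
    · rw [if_neg (by simp [hzL]), Finset.insert_eq_of_mem hzL, hLL]
    by_cases hz : z ∈ u
    · rw [if_pos (by simp [hz, hzL])]
    · have hzv : z ∉ v := fun h => hz ((hmem z).2 h)
      have : ∀ l : List ℕ, z ∉ l → keep (insert z L) l = keep L l := by
        intro l hl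
        refine keep_congr fun c hc => ?_
        have : c ≠ z := fun h => hl (h ▸ hc)
        simp [this]
      rw [if_neg (by simp [hz]), this u hz, this v hzv, hLL]
  have hLv : ∀ t ∈ L, v.count t = 1 := by
    intro t ht
    rw [← count_keep ht, ← hLL, count_keep ht, hLu t ht]
  have := hR.of_bal_of_hasSwaps hT hRT hsw (s := []) hbal (by
      intro t ht
      rw [List.append_nil, hbal.count_eq, hLv t ht]) (by
      intro z hz hzL
      rw [List.append_nil, hbal.count_eq]
      exact hv z ((hbal.mem_iff z).1 hz) hzL) (by
      simpa using hT.trans (hT.symm (hRT _ _ huu')) h)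
  exact hR.trans huu' (by simpa using this)

/-! ### Identities of a non-commutative monoid -/

theorem keep_singleton (x : ℕ) (l : List ℕ) : keep {x} l = List.replicate (l.count x) x := by
  rw [List.eq_replicate_iff]
  refine ⟨?_, fun b hb => by simpa using (mem_keep.1 hb).2⟩
  rw [List.count_eq_length_filter, keep]
  congr 2
  funext z
  by_cases h : z = x <;> simp [h]

theorem eq_of_keep_pair_eq {l m : List ℕ} (hl : l.Nodup) (hm : m.Nodup)
    (hlm : ∀ x, x ∈ l ↔ x ∈ m) (h : ∀ x ∈ l, ∀ y ∈ l, x ≠ y → keep {x, y} l = keep {x, y} m) :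
    l = m := by
  induction l generalizing m with
  | nil =>
    cases m with
    | nil => rfl
    | cons b m => simpa using (hlm b).2 (by simp)
  | cons a l ih =>
    cases m with
    | nil => simpa using (hlm a).1 (by simp)
    | cons b m =>
      have hab : a = b := by
        by_contra hab
        have := h a (by simp) b ((hlm b).2 (by simp)) hab
        rw [keep_cons_of_mem (by simp), keep_cons_of_mem (by simp)] at this
        exact hab (List.cons_eq_cons.1 this).1
      subst hab
      rw [List.nodup_cons] at hl hm
      congr 1
      refine ih hl.2 hm.2 (fun x => ?_) fun x hx y hy hxy => ?_
      · have := hlm x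
        simp only [List.mem_cons] at this
        by_cases hxa : x = a
        · subst hxa; simp [hl.1, hm.1]
        · simpa [hxa] using this
      · have := h x (by simp [hx]) y (by simp [hy]) hxy
        have ha : a ∉ ({x, y} : Finset ℕ) := by
          simp only [Finset.mem_insert, Finset.mem_singleton, not_or]
          exact ⟨fun h => hl.1 (h ▸ hx), fun h => hl.1 (h ▸ hy)⟩
        rwa [keep_cons_of_notMem ha, keep_cons_of_notMem ha] at this

/-- The identities of a monoid, for words that may be empty. -/
def MonId (S : Type*) [Monoid S] (u v : List ℕ) : Prop :=
  ∀ φ : ℕ → S, (u.map φ).prod = (v.map φ).prod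

section

variable {S : Type*} [Monoid S]

theorem prod_map_flatMap (u : List ℕ) (ψ : ℕ → List ℕ) (φ : ℕ → S) :
    ((u.flatMap ψ).map φ).prod = (u.map fun x => ((ψ x).map φ).prod).prod := by
  induction u with
  | nil => rfl
  | cons a u ih => simp [ih]

theorem isFI_monId : IsFI (MonId S) where
  equiv := ⟨fun _ _ => rfl, fun h φ => (h φ).symm, fun h h' φ => (h φ).trans (h' φ)⟩
  append p q h φ := by simp [h φ]
  subst ψ h φ := by rw [prod_map_flatMap, prod_map_flatMap]; exact h _

/-- The identity `xᵐ ≈ 1` makes every element a unit, and `σ₁` with `t₁ = t₂ = 1` reads `abab =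
baab`, from which `ab` cancels on the right. -/
theorem comm_of_monId_replicate_nil (h1 : MonId S [0, 1, 2, 0, 3, 1] [1, 0, 2, 0, 3, 1]) {m x : ℕ}
    (hm : m ≠ 0) (h : MonId S (List.replicate m x) []) (a b : S) : a * b = b * a := by
  have hu : ∀ s : S, IsUnit s := fun s =>
    IsUnit.of_pow_eq_one (by simpa using h fun _ => s) hm
  have := h1 fun | 0 => a | 1 => b | _ => 1
  simp only [List.map_cons, List.map_nil, List.prod_cons, List.prod_nil, mul_one, one_mul] at this
  exact ((hu a).mul (hu b)).mul_right_cancel (by simpa only [mul_assoc] using this)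

theorem mem_iff_of_monId (h1 : MonId S [0, 1, 2, 0, 3, 1] [1, 0, 2, 0, 3, 1])
    (hnc : ¬∀ a b : S, a * b = b * a) {u v : List ℕ} (h : MonId S u v) (x : ℕ) :
    x ∈ u ↔ x ∈ v := by
  have key : ∀ u v : List ℕ, MonId S u v → x ∈ u → x ∈ v := by
    intro u v h hx
    by_contra hxv
    have := isFI_monId.keep {x} h
    rw [keep_singleton, keep_singleton, List.count_eq_zero.2 hxv] at this
    exact hnc (comm_of_monId_replicate_nil h1 (List.count_pos_iff.2 hx).ne' this)
  exact ⟨key u v h, key v u (isFI_monId.symm h)⟩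

theorem comm_of_monId {x y : ℕ} (hxy : x ≠ y) (h : MonId S [x, y] [y, x]) (a b : S) :
    a * b = b * a := by
  simpa [hxy.symm] using h fun z => if z = x then a else b

theorem IsFI.replicate_letters {R : List ℕ → List ℕ → Prop} (hR : IsFI R) {n : ℕ}
    (h : R [0] (List.replicate n 0)) (u : List ℕ) : R u (u.flatMap fun x => List.replicate n x) := by
  induction u with
  | nil => exact hR.refl _
  | cons a u ih =>
    have h1 := hR.append [a] [] ih
    have h2 : R [a] (List.replicate n a) := by
      have := hR.subst (fun _ => [a]) h
      have h3 : ∀ n : ℕ, (List.replicate n 0).flatMap (fun _ : ℕ => [a]) = List.replicate n a := by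
        intro n
        induction n with
        | zero => rfl
        | succ n ih => simp [List.replicate_succ, ih]
      rw [h3] at this
      simpa using this
    have h3 := hR.append [] (u.flatMap fun x => List.replicate n x) h2
    simp only [List.append_nil, List.nil_append, List.singleton_append] at h1 h3
    exact hR.trans h1 h3

theorem count_flatMap_replicate (n x : ℕ) (u : List ℕ) :
    (u.flatMap fun y => List.replicate n y).count x = n * u.count x := by
  induction u with
  | nil => simp
  | cons a u ih =>
    rw [List.flatMap_cons, List.count_append, ih, List.count_replicate, List.count_cons]
    by_cases h : a = x <;> simp [h]; ring

/-- A criterion for a fully invariant congruence to contain all identities of a non-commutative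
monoid with `σ₁` and `σ_μ`. -/
theorem of_monId {R : List ℕ → List ℕ → Prop} (hT : IsSigmaFI (MonId S))
    (hnc : ¬∀ a b : S, a * b = b * a) (hR : IsSigmaFI R) (hRT : ∀ u v, R u v → MonId S u v)
    (hal : HasAlmostLinear R (MonId S)) (hsw : HasSwaps R (MonId S))
    (hpow : ∀ n, 2 ≤ n → MonId S [0] (List.replicate n 0) →
      ∃ n, 2 ≤ n ∧ R [0] (List.replicate n 0)) {u v : List ℕ} (h : MonId S u v) : R u v := by
  -- If `x ≈ xⁿ` holds, both words are replaced by words without linear letters and `L = ∅` serves.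
  -- Otherwise linear letters are preserved, and non-commutativity fixes their order.
  by_cases hex : ∃ n, 2 ≤ n ∧ MonId S [0] (List.replicate n 0)
  · obtain ⟨n, hn, hn'⟩ := hex
    obtain ⟨n, hn, hRn⟩ := hpow n hn hn'
    have hu := hR.replicate_letters hRn u
    have hv := hR.replicate_letters hRn v
    have h' := hT.trans (hT.symm (hRT _ _ hu)) (hT.trans h (hRT _ _ hv))
    have hcount : ∀ (u : List ℕ), ∀ z ∈ u.flatMap fun y => List.replicate n y, z ∉ (∅ : Finset ℕ) →
        2 ≤ (u.flatMap fun y => List.replicate n y).count z := by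
      intro u z hz _
      rw [← List.count_pos_iff, count_flatMap_replicate] at hz
      rw [count_flatMap_replicate]
      have : 1 ≤ u.count z := Nat.pos_of_mul_pos_left hz
      nlinarith
    have := hR.of_keep_eq hT hRT hal hsw (L := ∅) h' (mem_iff_of_monId hT.sigmaOne hnc h') (by simp)
      (hcount u) (hcount v) (by simp [keep])
    exact hR.trans hu (hR.trans this (hR.symm hv))
  · have hlin : ∀ u v : List ℕ, MonId S u v → ∀ x, u.count x = 1 → v.count x = 1 := by
      intro u v h x hx
      have hxv : x ∈ v := (mem_iff_of_monId hT.sigmaOne hnc h x).1 (List.count_pos_iff.1 (by omega))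
      have h1 := isFI_monId.keep {x} h
      rw [keep_singleton, keep_singleton, hx] at h1
      have h2 : MonId S [0] (List.replicate (v.count x) 0) := by
        intro φ
        simpa using h1 fun _ => φ 0
      have h3 : ¬ 2 ≤ v.count x := fun h => hex ⟨_, h, h2⟩
      have h4 := List.count_pos_iff.2 hxv
      omega
    have hmem := mem_iff_of_monId hT.sigmaOne hnc h
    set L := u.toFinset.filter (fun x => u.count x = 1) with hL
    have hLu : ∀ t ∈ L, u.count t = 1 := fun t ht => (Finset.mem_filter.1 ht).2
    have hLv : ∀ t ∈ L, v.count t = 1 := fun t ht => hlin u v h t (hLu t ht)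
    have hmemL : ∀ z, z ∈ L ↔ u.count z = 1 := by
      intro z
      simp only [hL, Finset.mem_filter, List.mem_toFinset, and_iff_right_iff_imp]
      intro hz
      exact List.count_pos_iff.1 (by omega)
    have hnodup : ∀ u : List ℕ, (∀ t ∈ L, u.count t = 1) → (keep L u).Nodup := by
      intro u hu
      rw [List.nodup_iff_count_le_one]
      intro a
      by_cases ha : a ∈ L
      · rw [count_keep ha, hu a ha]
      · rw [List.count_eq_zero.2]
        · omega
        · simp [ha]
    refine hR.of_keep_eq hT hRT hal hsw (L := L) h hmem hLu ?_ ?_ ?_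
    · intro z hz hzL
      rw [hmemL] at hzL
      have := List.count_pos_iff.2 hz
      omega
    · intro z hz hzL
      rw [hmemL] at hzL
      have h1 : v.count z ≠ 1 := fun h1 => hzL (hlin v u (isFI_monId.symm h) z h1)
      have := List.count_pos_iff.2 hz
      omega
    · refine eq_of_keep_pair_eq (hnodup u hLu) (hnodup v hLv) (fun x => by simp [hmem x]) ?_
      intro x hx y hy hxy
      have hx' := mem_keep.1 hx
      have hy' := mem_keep.1 hy
      have hsub : ({x, y} : Finset ℕ) ⊆ L := by
        intro z hz
        rcases Finset.mem_insert.1 hz with rfl | hz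
        · exact hx'.2
        · rw [Finset.mem_singleton.1 hz]; exact hy'.2
      rw [keep_keep, keep_keep, Finset.inter_eq_left.2 hsub]
      have hpair : ∀ u : List ℕ, (∀ t ∈ L, u.count t = 1) →
          keep {x, y} u = [x, y] ∨ keep {x, y} u = [y, x] := by
        intro u hu
        have hperm : (keep {x, y} u).Perm [x, y] := by
          rw [List.perm_iff_count]
          intro a
          by_cases ha : a ∈ ({x, y} : Finset ℕ)
          · rw [count_keep ha, hu a (hsub ha)]
            rcases Finset.mem_insert.1 ha with rfl | ha
            · simp [hxy.symm]
            · rw [Finset.mem_singleton.1 ha]; simp [hxy]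
          · rw [List.count_eq_zero.2 (by simp only [mem_keep]; tauto),
              List.count_eq_zero.2 (by simpa using ha)]
        have h2 : (keep {x, y} u).length = 2 := by rw [hperm.length_eq]; rfl
        obtain ⟨a, b, hab⟩ := List.length_eq_two.1 h2
        rw [hab] at hperm ⊢
        have ha : a = x ∨ a = y := by simpa using hperm.mem_iff.1 (by simp : a ∈ [a, b])
        rcases ha with rfl | rfl
        · have := (List.perm_cons a).1 hperm
          simp at this; simp [this]
        · have := (List.perm_cons a).1 (hperm.trans (List.Perm.swap a x []))
          simp at this; simp [this]
      have hT2 := isFI_monId.keep {x, y} h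
      rcases hpair u hLu with h3 | h3 <;> rcases hpair v hLv with h4 | h4 <;> rw [h3, h4] at hT2 ⊢
      · exact absurd (comm_of_monId hxy hT2) hnc
      · exact absurd (comm_of_monId hxy.symm hT2) hnc

end

/-! ### Well-quasi-orders -/

theorem WellQuasiOrdered.exists_finite_minorants {α : Type*} {r : α → α → Prop}
    (h : WellQuasiOrdered r) (A : Set α) : ∃ F ⊆ A, F.Finite ∧ ∀ a ∈ A, ∃ f ∈ F, r f a := by
  by_contra hcon
  push Not at hcon
  obtain ⟨f, -, hf⟩ := exists_seq_of_forall_finset_exists (· ∈ A) (fun x y => ¬ r x y) (by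
    intro s hs
    obtain ⟨a, ha, hra⟩ := hcon s hs s.finite_toSet
    exact ⟨a, ha, hra⟩)
  obtain ⟨m, n, hmn, hr⟩ := h f
  exact hf m n hmn hr

/-- Higman's lemma. -/
theorem wellQuasiOrdered_sublistForall₂ {α : Type*} [Preorder α] [WellQuasiOrderedLE α] :
    WellQuasiOrdered (List.SublistForall₂ (α := α) (β := α) (· ≤ ·)) := by
  rw [← Set.partiallyWellOrderedOn_univ_iff]
  have := Set.PartiallyWellOrderedOn.partiallyWellOrderedOn_sublistForall₂ (α := α) (· ≤ ·)
    (s := Set.univ) (Set.partiallyWellOrderedOn_univ_iff.2 wellQuasiOrdered_le)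
  simpa using this

/-! ### Finitely many almost-linear identities suffice -/

/-- The word `x ^ a₀ t₀ x ^ a₁ t₁ ⋯`. -/
def powWord (x : ℕ) : List ℕ → List ℕ → List ℕ
  | a :: as, t :: ts => List.replicate a x ++ t :: powWord x as ts
  | _, _ => []

theorem mem_powWord {x z : ℕ} {a ts : List ℕ} (h : z ∈ powWord x a ts) : z = x ∨ z ∈ ts := by
  induction a generalizing ts with
  | nil => simp [powWord] at h
  | cons i a ih =>
    cases ts with
    | nil => simp [powWord] at h
    | cons t ts =>
      simp only [powWord, List.mem_append, List.mem_cons, List.mem_replicate] at h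
      rcases h with h | h | h
      · exact Or.inl h.2
      · exact Or.inr (by simp [h])
      · rcases ih h with h | h
        · exact Or.inl h
        · exact Or.inr (by simp [h])

theorem count_powWord_le {x z : ℕ} (hz : z ≠ x) (a ts : List ℕ) :
    (powWord x a ts).count z ≤ ts.count z := by
  induction a generalizing ts with
  | nil => simp [powWord]
  | cons i a ih =>
    cases ts with
    | nil => simp [powWord]
    | cons t ts =>
      have := ih ts
      have h0 : (List.replicate i x).count z = 0 := by
        rw [List.count_eq_zero]; simp [hz]
      simp only [powWord, List.count_append, List.count_cons, h0]
      omega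

theorem flatMap_replicate {x x' : ℕ} {φ : ℕ → List ℕ} (h : φ x = [x']) (n : ℕ) :
    (List.replicate n x).flatMap φ = List.replicate n x' := by
  induction n with
  | zero => rfl
  | succ n ih => simp [List.replicate_succ, ih, h]

theorem flatMap_update_of_notMem {φ : ℕ → List ℕ} {t : ℕ} {w l : List ℕ} (h : t ∉ l) :
    l.flatMap (Function.update φ t w) = l.flatMap φ :=
  flatMap_congr_mem fun x hx => by
    rw [Function.update_of_ne]
    rintro rfl; exact h hx

/-- An embedding of exponent lists lets an identity for `a` rewrite the word of `a'`: the surplus of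
a matched exponent and all unmatched blocks go into the image of the preceding matched linear
letter, or into the outer context. Each changed exponent receives the same surplus on both sides, so
a lexicographic decrease survives. -/
theorem exists_powWord_transfer {a a' : List ℕ} (h : List.SublistForall₂ (· ≤ ·) a a')
    {x x' : ℕ} {ts ts' b : List ℕ} (hx : x ∉ ts) (hts : ts.Nodup) (ha : a.length = ts.length)
    (hb : b.length = a.length) (ha' : a'.length = ts'.length) :
    ∃ (P Q : List ℕ) (φ : ℕ → List ℕ) (b' : List ℕ), φ x = [x'] ∧ b'.length = a'.length ∧
      powWord x' a' ts' = P ++ (powWord x a ts).flatMap φ ++ Q ∧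
      powWord x' b' ts' = P ++ (powWord x b ts).flatMap φ ++ Q ∧
      (List.Lex (· < ·) b a → List.Lex (· < ·) b' a') := by
  induction h generalizing ts ts' b with
  | @nil l =>
    obtain rfl := List.length_eq_zero_iff.1 hb
    exact ⟨[], powWord x' l ts', fun _ => [x'], l, rfl, rfl, by simp [powWord],
      by simp [powWord], fun h => by cases h⟩
  | @cons i i' a a' hi h ih =>
    obtain ⟨t, ts, rfl⟩ := List.exists_cons_of_length_pos (l := ts) (by rw [← ha]; simp)
    obtain ⟨t', ts', rfl⟩ := List.exists_cons_of_length_pos (l := ts') (by rw [← ha']; simp)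
    obtain ⟨j, b, rfl⟩ := List.exists_cons_of_length_pos (l := b) (by rw [hb]; simp)
    rw [List.nodup_cons] at hts
    rw [List.mem_cons, not_or] at hx
    obtain ⟨P, Q, φ, b', hφ, hb', h1, h2, h3⟩ := ih (ts := ts) (ts' := ts') (b := b) hx.2 hts.2
      (by simpa using ha) (by simpa using hb) (by simpa using ha')
    have ht : ∀ a : List ℕ, t ∉ powWord x a ts := fun a h => by
      rcases mem_powWord h with h | h
      · exact hx.1 h.symm
      · exact hts.1 h
    have hφ' : Function.update φ t (t' :: P) x = [x'] := by
      rw [Function.update_of_ne hx.1, hφ]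
    refine ⟨List.replicate (i' - i) x', Q, Function.update φ t (t' :: P), (j + (i' - i)) :: b',
      hφ', by simp [hb'], ?_, ?_, ?_⟩
    · simp only [powWord, List.flatMap_append, List.flatMap_cons, Function.update_self,
        flatMap_replicate hφ', flatMap_update_of_notMem (ht a), h1]
      simp only [← List.append_assoc, ← List.replicate_add, Nat.sub_add_cancel hi]
      simp
    · simp only [powWord, List.flatMap_append, List.flatMap_cons, Function.update_self,
        flatMap_replicate hφ', flatMap_update_of_notMem (ht b), h2]
      simp only [← List.append_assoc, ← List.replicate_add]
      simp [Nat.add_comm j]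
    · intro hlex
      cases hlex with
      | rel h => exact .rel (by omega)
      | cons h => rw [Nat.add_sub_cancel' hi]; exact .cons (h3 h)
  | @cons_right i' a a' h ih =>
    obtain ⟨t', ts', rfl⟩ := List.exists_cons_of_length_pos (l := ts') (by rw [← ha']; simp)
    obtain ⟨P, Q, φ, b', hφ, hb', h1, h2, h3⟩ := ih (ts := ts) (ts' := ts') (b := b) hx hts
      ha hb (by simpa using ha')
    refine ⟨List.replicate i' x' ++ t' :: P, Q, φ, i' :: b', hφ, by simp [hb'], ?_, ?_, ?_⟩
    · simp [powWord, h1]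
    · simp [powWord, h2]
    · exact fun hlex => .cons (h3 hlex)

theorem exists_eq_powWord {L : Finset ℕ} {x : ℕ} (hx : x ∉ L) {α : List ℕ}
    (h : ∀ z ∈ α, z ∈ insert x L) : ∃ a : List ℕ, a.length = (keep L α).length + 1 ∧
      ∀ t, α ++ [t] = powWord x a (keep L α ++ [t]) := by
  induction α with
  | nil => exact ⟨[0], rfl, fun t => rfl⟩
  | cons c α ih =>
    obtain ⟨a, ha, hat⟩ := ih fun z hz => h z (by simp [hz])
    rcases Finset.mem_insert.1 (h c (by simp)) with rfl | hc
    · obtain ⟨i, a, rfl⟩ := List.exists_cons_of_length_pos (l := a) (by omega)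
      refine ⟨(i + 1) :: a, by rw [keep_cons_of_notMem hx]; simpa using ha, fun t => ?_⟩
      rw [keep_cons_of_notMem hx, List.cons_append, hat t]
      obtain ⟨t', ts, hts⟩ := List.exists_cons_of_ne_nil
        (List.append_ne_nil_of_right_ne_nil (keep L α) (List.cons_ne_nil t []))
      rw [hts]
      simp [powWord, List.replicate_succ]
    · refine ⟨0 :: a, by rw [keep_cons_of_mem hc]; simpa using ha, fun t => ?_⟩
      rw [keep_cons_of_mem hc, List.cons_append, hat t]
      simp [powWord]

/-- Call an exponent list reducible if `T` identifies its word with that of a lexicographically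
smaller list of the same length. One reduction for each of finitely many minimal reducible lists
suffices to reduce every list to an irreducible one, and two irreducible lists identified by `T`
coincide. -/
theorem exists_finite_almostLinear {T : List ℕ → List ℕ → Prop} (hT : IsFI T) :
    ∃ E : Set (List ℕ × List ℕ), E.Finite ∧
      (∀ e ∈ E, T e.1 e.2 ∧ ∃ x, ∀ z, z ≠ x → e.1.count z ≤ 1 ∧ e.2.count z ≤ 1) ∧
      ∀ R, IsFI R → (∀ u v, R u v → T u v) → (∀ e ∈ E, R e.1 e.2) → HasAlmostLinear R T := by
  set D : List ℕ → (ℕ × List ℕ × List ℕ) → Prop := fun a d =>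
    d.1 ∉ d.2.1 ∧ d.2.1.Nodup ∧ a.length = d.2.1.length ∧ d.2.2.length = a.length ∧
      List.Lex (· < ·) d.2.2 a ∧ T (powWord d.1 a d.2.1) (powWord d.1 d.2.2 d.2.1) with hD
  obtain ⟨F, hFA, hF, hmin⟩ := WellQuasiOrdered.exists_finite_minorants
    (wellQuasiOrdered_sublistForall₂ (α := ℕ)) {a | ∃ d, D a d}
  have hFA' : ∀ a, ∃ d, a ∈ F → D a d := fun a => by
    by_cases ha : a ∈ F
    · obtain ⟨d, hd⟩ := hFA ha
      exact ⟨d, fun _ => hd⟩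
    · exact ⟨(0, [], []), fun h => absurd h ha⟩
  choose d hd using hFA'
  refine ⟨(fun a => (powWord (d a).1 a (d a).2.1, powWord (d a).1 (d a).2.2 (d a).2.1)) '' F,
    hF.image _, ?_, ?_⟩
  · rintro _ ⟨a, ha, rfl⟩
    obtain ⟨h1, h2, h3, h4, h5, h6⟩ := hd a ha
    refine ⟨h6, (d a).1, fun z hz => ?_⟩
    have := List.nodup_iff_count_le_one.1 h2 z
    exact ⟨(count_powWord_le hz _ _).trans this, (count_powWord_le hz _ _).trans this⟩
  · intro R hR hRT hE
    have red : ∀ (x : ℕ) (ts : List ℕ), x ∉ ts → ts.Nodup → ∀ a : List ℕ, a.length = ts.length →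
        ∃ b, b.length = ts.length ∧ R (powWord x a ts) (powWord x b ts) ∧
          ∀ c, c.length = ts.length → T (powWord x b ts) (powWord x c ts) →
            ¬ List.Lex (· < ·) c b := by
      intro x ts hx hts a
      -- The lexicographic order is not well founded on all lists, but on lists of equal length it
      -- agrees with the shortlex order, which is.
      induction a using (List.Shortlex.wf (r := (· < ·)) (wellFounded_lt (α := ℕ))).induction with
      | _ a ih =>
        intro ha
        by_cases hred : ∃ c, c.length = ts.length ∧ T (powWord x a ts) (powWord x c ts) ∧
            List.Lex (· < ·) c a
        · obtain ⟨c, hc, hTc, hlex⟩ := hred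
          obtain ⟨f, hf, hfa⟩ := hmin a ⟨(x, ts, c), hx, hts, ha, hc.trans ha.symm, hlex, hTc⟩
          obtain ⟨h1, h2, h3, h4, h5, -⟩ := hd f hf
          obtain ⟨P, Q, φ, b', -, hb', e1, e2, hlex'⟩ :=
            exists_powWord_transfer hfa (x' := x) h1 h2 h3 h4 ha
          have hRf := hR.append P Q (hR.subst φ (hE _ ⟨f, hf, rfl⟩))
          rw [← e1, ← e2] at hRf
          obtain ⟨b, hb, hRb, hirr⟩ := ih b' (List.Shortlex.of_lex hb' (hlex' h5)) (hb'.trans ha)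
          exact ⟨b, hb, hR.trans hRf hRb, hirr⟩
        · exact ⟨a, ha, hR.refl _, fun c hc hTc hlex => hred ⟨c, hc, hTc, hlex⟩⟩
    intro L x α β hx hL hα hβ hαβ hTαβ
    obtain ⟨a, ha, hat⟩ := exists_eq_powWord hx hα
    obtain ⟨b, hb, hbt⟩ := exists_eq_powWord hx hβ
    -- Words of the form `powWord` end in a linear letter; a fresh `t` is appended for this and
    -- erased at the end.
    obtain ⟨t, ht⟩ := Infinite.exists_notMem_finset (insert x L)
    rw [Finset.mem_insert, not_or] at ht
    rw [← hαβ] at hb hbt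
    have hxts : x ∉ keep L α ++ [t] := by
      simp [hx, Ne.symm ht.1]
    have hts : (keep L α ++ [t]).Nodup := by
      rw [List.nodup_append]
      refine ⟨?_, by simp, ?_⟩
      · rw [List.nodup_iff_count_le_one]
        intro c
        by_cases hc : c ∈ L
        · rw [count_keep hc]; exact hL c hc
        · rw [List.count_eq_zero.2]
          · omega
          · simp [hc]
      · intro c hc c' hc' hcc
        rw [List.mem_singleton] at hc'
        rw [hcc, hc'] at hc
        exact ht.2 (mem_keep.1 hc).2
    have hT1 : T (α ++ [t]) (β ++ [t]) := by simpa using hT.append [] [t] hTαβ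
    rw [hat t, hbt t] at hT1
    obtain ⟨a', ha', hRa, hirra⟩ := red x _ hxts hts a (by simpa using ha)
    obtain ⟨b', hb', hRb, hirrb⟩ := red x _ hxts hts b (by simpa using hb)
    have hT2 : T (powWord x a' (keep L α ++ [t])) (powWord x b' (keep L α ++ [t])) :=
      hT.trans (hT.symm (hRT _ _ hRa)) (hT.trans hT1 (hRT _ _ hRb))
    have hab : a' = b' := by
      have h1 := hirra b' hb' hT2
      have h2 := hirrb a' ha' (hT.symm hT2)
      have := (inferInstance : Std.Trichotomous (List.Shortlex (fun a b : ℕ => a < b))).trichotomous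
        a' b'
      rw [List.shortlex_iff_lex (ha'.trans hb'.symm),
        List.shortlex_iff_lex (hb'.trans ha'.symm)] at this
      exact this h2 h1
    rw [hab] at hRa
    have hR1 := hR.trans hRa (hR.symm hRb)
    rw [← hat t, ← hbt t] at hR1
    have hR2 := hR.subst (fun z => if z ∈ insert x L then [z] else []) hR1
    rw [List.flatMap_append, List.flatMap_append, flatMap_id fun z hz => if_pos (hα z hz),
      flatMap_id fun z hz => if_pos (hβ z hz)] at hR2
    simpa [ht] using hR2

/-! ### Finitely many swaps of last occurrences suffice -/

theorem IsSigmaFI.of_perm (h : IsSigmaFI R) {a b : List ℕ} (hab : a.Perm b) (p : List ℕ)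
    {s : List ℕ} (hs : ∀ z ∈ a, z ∈ s) : R (p ++ (a ++ s)) (p ++ (b ++ s)) := by
  have hbal : Bal ∅ a b := fun x => by
    rw [insert_empty_eq, keep_singleton, keep_singleton, hab.count_eq]
  simpa using h.append p [] (h.of_bal hbal fun z hz _ => hs z hz)

/-- The word `c ^ m y ^ n`. -/
def powPair (c y : ℕ) (e : ℕ × ℕ) : List ℕ := List.replicate e.1 c ++ List.replicate e.2 y

theorem mem_powPair {c y z : ℕ} {e : ℕ × ℕ} (h : z ∈ powPair c y e) : z = c ∨ z = y := by
  simp only [powPair, List.mem_append, List.mem_replicate] at h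
  tauto

theorem powPair_perm_sub {c y : ℕ} {e e' : ℕ × ℕ} (h : e ≤ e') :
    (powPair c y e').Perm (powPair c y (e' - e) ++ powPair c y e) := by
  obtain ⟨h1, h2⟩ := Prod.le_def.1 h
  rw [List.perm_iff_count]
  intro z
  simp only [powPair, List.count_append, List.count_replicate, Prod.fst_sub, Prod.snd_sub]
  split_ifs <;> omega

theorem flatMap_powPair {c y c' y' : ℕ} {φ : ℕ → List ℕ} (hc : φ c = [c']) (hy : φ y = [y'])
    (e : ℕ × ℕ) : (powPair c y e).flatMap φ = powPair c' y' e := by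
  simp [powPair, flatMap_replicate hc, flatMap_replicate hy]

/-- The word `c ^ m₀ y ^ n₀ t₀ c ^ m₁ y ^ n₁ t₁ ⋯`. -/
def pairWord (c y : ℕ) : List (ℕ × ℕ) → List ℕ → List ℕ
  | e :: l, t :: ts => powPair c y e ++ t :: pairWord c y l ts
  | _, _ => []

theorem mem_pairWord {c y z : ℕ} {l : List (ℕ × ℕ)} {ts : List ℕ} (h : z ∈ pairWord c y l ts) :
    z = c ∨ z = y ∨ z ∈ ts := by
  induction l generalizing ts with
  | nil => simp [pairWord] at h
  | cons e l ih =>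
    cases ts with
    | nil => simp [pairWord] at h
    | cons t ts =>
      simp only [pairWord, List.mem_append, List.mem_cons] at h ⊢
      rcases h with h | h | h
      · have := mem_powPair h; tauto
      · tauto
      · have := ih h; tauto

theorem count_powPair {c y z : ℕ} (hc : z ≠ c) (hy : z ≠ y) (e : ℕ × ℕ) :
    (powPair c y e).count z = 0 :=
  List.count_eq_zero.2 fun h => by have := mem_powPair h; tauto

theorem count_pairWord_le {c y z : ℕ} (hc : z ≠ c) (hy : z ≠ y) (l : List (ℕ × ℕ)) (ts : List ℕ) :
    (pairWord c y l ts).count z ≤ ts.count z := by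
  induction l generalizing ts with
  | nil => simp [pairWord]
  | cons e l ih =>
    cases ts with
    | nil => simp [pairWord]
    | cons t ts =>
      have := ih ts
      simp only [pairWord, List.count_append, List.count_cons, count_powPair hc hy]
      omega

/-- The analogue of `exists_powWord_transfer` for two letters. It holds only up to `R`, since the
surplus of a block must be commuted to its front, which is allowed because both letters recur in
`s`. The word `M` leaves room for the surplus of the block after the last linear letter. -/
theorem exists_pairWord_transfer {l l' : List (ℕ × ℕ)} (h : List.SublistForall₂ (· ≤ ·) l l')
    {c y c' y' : ℕ} {ts ts' : List ℕ} (hcy : c ≠ y) (hc : c ∉ ts) (hy : y ∉ ts) (hts : ts.Nodup)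
    (hl : l.length = ts.length) (hl' : l'.length = ts'.length) (M : List ℕ) :
    ∃ (P : List ℕ) (φ : ℕ → List ℕ), φ c = [c'] ∧ φ y = [y'] ∧
      ∀ R, IsSigmaFI R → ∀ p s : List ℕ, c' ∈ s → y' ∈ s →
        R (p ++ (pairWord c' y' l' ts' ++ M ++ s)) (p ++ (P ++ (pairWord c y l ts).flatMap φ ++ s)) := by
  induction h generalizing ts ts' with
  | @nil l' =>
    refine ⟨pairWord c' y' l' ts' ++ M, fun z => if z = c then [c'] else [y'], by simp,
      by simp [hcy.symm], fun R hR p s _ _ => ?_⟩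
    simpa [pairWord] using hR.refl _
  | @cons e e' l l' he h ih =>
    obtain ⟨t, ts, rfl⟩ := List.exists_cons_of_length_pos (l := ts) (by rw [← hl]; simp)
    obtain ⟨t', ts', rfl⟩ := List.exists_cons_of_length_pos (l := ts') (by rw [← hl']; simp)
    rw [List.nodup_cons] at hts
    rw [List.mem_cons, not_or] at hc hy
    obtain ⟨P, φ, hφc, hφy, hφ⟩ := ih (ts := ts) (ts' := ts') hc.2 hy.2 hts.2 (by simpa using hl)
      (by simpa using hl')
    have ht : t ∉ pairWord c y l ts := fun h => by
      rcases mem_pairWord h with h | h | h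
      · exact hc.1 h.symm
      · exact hy.1 h.symm
      · exact hts.1 h
    have hφc' : Function.update φ t (t' :: P) c = [c'] := by rw [Function.update_of_ne hc.1, hφc]
    have hφy' : Function.update φ t (t' :: P) y = [y'] := by rw [Function.update_of_ne hy.1, hφy]
    refine ⟨powPair c' y' (e' - e), Function.update φ t (t' :: P), hφc', hφy',
      fun R hR p s hcs hys => ?_⟩
    simp only [pairWord, List.flatMap_append, List.flatMap_cons, Function.update_self,
        flatMap_powPair hφc' hφy', flatMap_update_of_notMem ht]
    have h1 := hφ R hR (p ++ powPair c' y' e' ++ [t']) s hcs hys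
    have h2 := hR.of_perm (powPair_perm_sub (c := c') (y := y') he) p
      (s := t' :: (P ++ (pairWord c y l ts).flatMap φ ++ s)) (by
        intro z hz
        rcases mem_powPair hz with rfl | rfl
        · simp [hcs]
        · simp [hys])
    simp only [List.append_assoc, List.cons_append, List.nil_append] at h1 h2 ⊢
    exact hR.trans h1 h2
  | @cons_right e' l l' h ih =>
    obtain ⟨t', ts', rfl⟩ := List.exists_cons_of_length_pos (l := ts') (by rw [← hl']; simp)
    obtain ⟨P, φ, hφc, hφy, hφ⟩ := ih (ts := ts) (ts' := ts') hc hy hts hl (by simpa using hl')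
    refine ⟨powPair c' y' e' ++ t' :: P, φ, hφc, hφy, fun R hR p s hcs hys => ?_⟩
    have h1 := hφ R hR (p ++ powPair c' y' e' ++ [t']) s hcs hys
    simpa [pairWord] using h1

/-- Between consecutive linear letters the occurrences of `c` and `y` can be sorted, none of them
being last. The pair `e` records the block after the final linear letter. -/
theorem exists_pairWord_normalForm {L : Finset ℕ} {c y : ℕ} (hc : c ∉ L) (hy : y ∉ L) {p : List ℕ}
    (hp : ∀ z ∈ p, z = c ∨ z = y ∨ z ∈ L) :
    ∃ (l : List (ℕ × ℕ)) (e : ℕ × ℕ), l.length = (keep L p).length ∧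
      p.Perm (pairWord c y l (keep L p) ++ powPair c y e) ∧
      ∀ R, IsSigmaFI R → ∀ q s : List ℕ, c ∈ s → y ∈ s →
        R (q ++ (p ++ s)) (q ++ (pairWord c y l (keep L p) ++ powPair c y e ++ s)) := by
  induction p with
  | nil =>
    exact ⟨[], (0, 0), rfl, by simp [pairWord, powPair], fun R hR q s _ _ => by
      simpa [pairWord, powPair] using hR.refl _⟩
  | cons d p ih =>
    obtain ⟨l, e, hl, hperm, hR⟩ := ih fun z hz => hp z (by simp [hz])
    by_cases hd : d ∈ L
    · refine ⟨(0, 0) :: l, e, by simp [keep_cons_of_mem hd, hl], ?_, ?_⟩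
      · simpa [keep_cons_of_mem hd, pairWord, powPair] using hperm
      · intro R hR' q s hcs hys
        have := hR R hR' (q ++ [d]) s hcs hys
        simpa [keep_cons_of_mem hd, pairWord, powPair] using this
    · have hd' : d = c ∨ d = y := by
        have := hp d (by simp)
        tauto
      rw [keep_cons_of_notMem hd]
      have hadd : ∀ e : ℕ × ℕ, ∃ e', (d :: powPair c y e).Perm (powPair c y e') := by
        intro e
        rcases hd' with rfl | rfl
        · exact ⟨(e.1 + 1, e.2), by simp [powPair, List.replicate_succ]⟩
        · refine ⟨(e.1, e.2 + 1), ?_⟩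
          simp only [powPair, List.replicate_succ]
          exact List.perm_middle.symm
      have hmem : ∀ (e : ℕ × ℕ) (s : List ℕ), c ∈ s → y ∈ s → ∀ z ∈ d :: powPair c y e, z ∈ s := by
        intro e s hcs hys z hz
        have : z = c ∨ z = y := by
          rcases List.mem_cons.1 hz with rfl | hz
          · exact hd'
          · exact mem_powPair hz
        rcases this with rfl | rfl <;> assumption
      cases l with
      | nil =>
        obtain ⟨e', he'⟩ := hadd e
        refine ⟨[], e', hl, ?_, fun R hR' q s hcs hys => ?_⟩
        · exact (hperm.cons d).trans (by simpa [pairWord] using he')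
        · have h1 := hR R hR' (q ++ [d]) s hcs hys
          have h2 := hR'.of_perm he' q (hmem e s hcs hys)
          simp only [pairWord, List.append_assoc, List.cons_append, List.nil_append] at h1 h2 ⊢
          exact hR'.trans h1 h2
      | cons e0 l =>
        obtain ⟨e', he'⟩ := hadd e0
        obtain ⟨t, ts, hts⟩ := List.exists_cons_of_length_pos (l := keep L p) (by rw [← hl]; simp)
        rw [hts] at hl hperm hR ⊢
        refine ⟨e' :: l, e, by simpa using hl, ?_, fun R hR' q s hcs hys => ?_⟩
        · refine (hperm.cons d).trans ?_
          have := he'.append_right (t :: (pairWord c y l ts ++ powPair c y e))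
          simpa [pairWord] using this
        · have h1 := hR R hR' (q ++ [d]) s hcs hys
          have h2 := hR'.of_perm he' q (s := t :: (pairWord c y l ts ++ powPair c y e ++ s))
            (hmem e0 _ (by simp [hcs]) (by simp [hys]))
          simp only [pairWord, List.append_assoc, List.cons_append, List.nil_append] at h1 h2 ⊢
          exact hR'.trans h1 h2

/-- `l ≈ r` swaps adjacent occurrences of the only two letters that are non-linear in `l`. -/
def IsSwap (l r : List ℕ) : Prop :=
  ∃ (p q : List ℕ) (c y : ℕ), l = p ++ c :: y :: q ∧ r = p ++ y :: c :: q ∧ c ≠ y ∧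
    c ∈ p ++ q ∧ y ∈ p ++ q ∧ ∀ z, z ≠ c → z ≠ y → (p ++ q).count z ≤ 1

/-- The normal form codes the prefix before the two swapped letters by a list of exponent pairs and
one final pair. If a swap after one prefix is allowed, it transfers to every prefix with a larger
code, so the minimal codes of swaps in `T` suffice. -/
theorem exists_finite_swaps {T : List ℕ → List ℕ → Prop} (hT : IsSigmaFI T) :
    ∃ E : Set (List ℕ × List ℕ), E.Finite ∧ (∀ e ∈ E, T e.1 e.2 ∧ IsSwap e.1 e.2) ∧
      ∀ R, IsSigmaFI R → (∀ e ∈ E, R e.1 e.2) → HasSwaps R T := by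
  set W : List (ℕ × ℕ) × (ℕ × ℕ) → ℕ × ℕ × List ℕ → List ℕ := fun a d =>
    pairWord d.1 d.2.1 a.1 d.2.2 ++ powPair d.1 d.2.1 a.2 with hW
  set D : List (ℕ × ℕ) × (ℕ × ℕ) → ℕ × ℕ × List ℕ → Prop := fun a d =>
    d.1 ≠ d.2.1 ∧ d.1 ∉ d.2.2 ∧ d.2.1 ∉ d.2.2 ∧ d.2.2.Nodup ∧ a.1.length = d.2.2.length ∧
      d.1 ∈ W a d ∧ d.2.1 ∈ W a d ∧ T (W a d ++ [d.1, d.2.1]) (W a d ++ [d.2.1, d.1]) with hD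
  have : IsPreorder (List (ℕ × ℕ)) (List.SublistForall₂ (α := ℕ × ℕ) (β := ℕ × ℕ) (· ≤ ·)) := {}
  obtain ⟨F, hFA, hF, hmin⟩ := WellQuasiOrdered.exists_finite_minorants
    ((wellQuasiOrdered_sublistForall₂ (α := ℕ × ℕ)).prod (wellQuasiOrdered_le (α := ℕ × ℕ)))
    {a | ∃ d, D a d}
  have hFA' : ∀ a, ∃ d, a ∈ F → D a d := fun a => by
    by_cases ha : a ∈ F
    · obtain ⟨d, hd⟩ := hFA ha
      exact ⟨d, fun _ => hd⟩
    · exact ⟨(0, 0, []), fun h => absurd h ha⟩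
  choose d hd using hFA'
  refine ⟨(fun a => (W a (d a) ++ [(d a).1, (d a).2.1], W a (d a) ++ [(d a).2.1, (d a).1])) '' F,
    hF.image _, ?_, ?_⟩
  · rintro _ ⟨a, ha, rfl⟩
    obtain ⟨h1, h2, h3, h4, h5, h6, h7, h8⟩ := hd a ha
    refine ⟨h8, W a (d a), [], (d a).1, (d a).2.1, rfl, rfl, h1, by simpa using h6,
      by simpa using h7, fun z hz hz' => ?_⟩
    have := List.nodup_iff_count_le_one.1 h4 z
    rw [List.append_nil, hW]
    simp only [List.count_append, count_powPair hz hz']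
    exact (count_pairWord_le hz hz' _ _).trans this
  · intro R hR hE L p c y hcy hcL hyL hcp hyp hL hp hTp
    obtain ⟨l, e, hl, hperm, hnf⟩ := exists_pairWord_normalForm hcL hyL hp
    set ts := keep L p with hts
    have htsnd : ts.Nodup := by
      rw [List.nodup_iff_count_le_one]
      intro t
      by_cases ht : t ∈ L
      · rw [hts, count_keep ht]; exact hL t ht
      · rw [List.count_eq_zero.2]
        · omega
        · simp [hts, ht]
    have hR1 := hnf R hR [] [c, y] (by simp) (by simp)
    have hR2 := hnf R hR [] [y, c] (by simp) (by simp)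
    have hT1 := hnf T hT [] [c, y] (by simp) (by simp)
    have hT2 := hnf T hT [] [y, c] (by simp) (by simp)
    simp only [List.nil_append] at hR1 hR2 hT1 hT2
    obtain ⟨f, hf, hfl, hfe⟩ := hmin (l, e) ⟨(c, y, ts), hcy, by simp [hts, hcL], by simp [hts, hyL],
      htsnd, hl, hperm.mem_iff.1 hcp, hperm.mem_iff.1 hyp,
      hT.trans (hT.symm hT1) (hT.trans hTp hT2)⟩
    obtain ⟨h1, h2, h3, h4, h5, -, -, -⟩ := hd f hf
    obtain ⟨P, φ, hφc, hφy, hφ⟩ := exists_pairWord_transfer hfl (c' := c) (y' := y) h1 h2 h3 h4 h5 hl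
      (powPair c y (e - f.2))
    have key : ∀ s : List ℕ, c ∈ s → y ∈ s → R (pairWord c y l ts ++ powPair c y e ++ s)
        (P ++ (W f (d f)).flatMap φ ++ s) := by
      intro s hcs hys
      have h1 := hR.of_perm (powPair_perm_sub (c := c) (y := y) hfe) (pairWord c y l ts) (s := s) (by
        intro z hz
        rcases mem_powPair hz with rfl | rfl <;> assumption)
      have h2 := hφ R hR [] (powPair c y f.2 ++ s) (by simp [hcs]) (by simp [hys])
      rw [hW]
      simp only [List.flatMap_append, flatMap_powPair hφc hφy]
      simp only [List.append_assoc, List.nil_append] at h1 h2 ⊢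
      exact hR.trans h1 h2
    have hRf := hR.append P [] (hR.subst φ (hE _ ⟨f, hf, rfl⟩))
    simp only [List.flatMap_append, List.flatMap_cons, List.flatMap_nil, hφc, hφy,
      List.append_nil, List.cons_append, List.nil_append] at hRf
    have k1 := key [c, y] (by simp) (by simp)
    have k2 := key [y, c] (by simp) (by simp)
    simp only [List.append_assoc] at hR1 hR2 k1 k2 hRf
    exact hR.trans hR1 (hR.trans k1 (hR.trans hRf (hR.trans (hR.symm k2) (hR.symm hR2))))

/-! ### From possibly empty lists back to semigroup words -/

/-- The word with a given nonempty list of letters. -/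
def word : List ℕ → Word
  | [] => ⟨0, []⟩
  | a :: l => ⟨a, l⟩

theorem letters_word {l : List ℕ} (h : l ≠ []) : letters (word l) = l := by
  cases l with
  | nil => exact absurd rfl h
  | cons a l => rfl

theorem letters_ne_nil (u : Word) : letters u ≠ [] := List.cons_ne_nil _ _

theorem word_letters (u : Word) : word (letters u) = u := rfl

theorem letters_injective : Function.Injective letters := fun u v h => by
  rw [← word_letters u, h, word_letters]

theorem letters_mul (u v : Word) : letters (u * v) = letters u ++ letters v := by
  simp [letters]

theorem letters_lift (φ : ℕ → Word) (u : Word) :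
    letters (FreeSemigroup.lift φ u) = (letters u).flatMap fun x => letters (φ x) := by
  induction u using FreeSemigroup.recOnMul with
  | ih1 x => rw [FreeSemigroup.lift_of]; simp [letters, FreeSemigroup.of]
  | ih2 x y h1 h2 => rw [map_mul, letters_mul, letters_mul, h1, h2, List.flatMap_append]

theorem lift_eq_prod {S : Type*} [Monoid S] (φ : ℕ → S) (u : Word) :
    FreeSemigroup.lift φ u = ((letters u).map φ).prod := by
  induction u using FreeSemigroup.recOnMul with
  | ih1 x => rw [FreeSemigroup.lift_of]; simp [letters, FreeSemigroup.of]
  | ih2 x y h1 h2 => rw [map_mul, letters_mul, h1, h2, List.map_append, List.prod_append]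

theorem satisfies_iff {S : Type*} [Monoid S] (e : Identity) :
    Satisfies S e ↔ MonId S (letters e.lhs) (letters e.rhs) := by
  simp only [Satisfies, MonId, lift_eq_prod]

/-- Derivability for words that may be empty. -/
def ListDerives (B : Set Identity) (u v : List ℕ) : Prop :=
  (u = [] ∧ v = []) ∨ ∃ U V, letters U = u ∧ letters V = v ∧ Derives B U V

theorem listDerives_letters {B : Set Identity} {U V : Word} :
    ListDerives B (letters U) (letters V) ↔ Derives B U V := by
  constructor
  · rintro (⟨h, -⟩ | ⟨U', V', hU, hV, h⟩)
    · exact absurd h (letters_ne_nil U)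
    · rwa [letters_injective hU, letters_injective hV] at h
  · exact fun h => Or.inr ⟨U, V, rfl, rfl, h⟩

theorem ListDerives.refl (B : Set Identity) (u : List ℕ) : ListDerives B u u := by
  by_cases h : u = []
  · exact Or.inl ⟨h, h⟩
  · exact Or.inr ⟨word u, word u, letters_word h, letters_word h, .refl _⟩

theorem listDerives_equivalence (B : Set Identity) : Equivalence (ListDerives B) where
  refl := ListDerives.refl B
  symm := by
    rintro u v (⟨h, h'⟩ | ⟨U, V, hU, hV, h⟩)
    · exact Or.inl ⟨h', h⟩
    · exact Or.inr ⟨V, U, hV, hU, h.symm⟩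
  trans := by
    rintro u v w (⟨rfl, rfl⟩ | ⟨U, V, rfl, rfl, h⟩) h'
    · exact h'
    · rcases h' with ⟨h1, -⟩ | ⟨V', W, hV, rfl, h'⟩
      · exact absurd h1 (letters_ne_nil V)
      · rw [letters_injective hV] at h'
        exact Or.inr ⟨U, W, rfl, rfl, h.trans h'⟩

theorem ListDerives.append {B : Set Identity} {u v u' v' : List ℕ} (h : ListDerives B u v)
    (h' : ListDerives B u' v') : ListDerives B (u ++ u') (v ++ v') := by
  rcases h with ⟨rfl, rfl⟩ | ⟨U, V, rfl, rfl, h⟩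
  · exact h'
  · rcases h' with ⟨rfl, rfl⟩ | ⟨U', V', rfl, rfl, h'⟩
    · rw [List.append_nil, List.append_nil]
      exact Or.inr ⟨U, V, rfl, rfl, h⟩
    · exact Or.inr ⟨U * U', V * V', letters_mul _ _, letters_mul _ _, h.mul h'⟩

/-- The identities obtained from pairs of lists by deleting letters. -/
def deletions (E : Set (List ℕ × List ℕ)) : Set Identity :=
  {e | ∃ p ∈ E, ∃ K : Finset ℕ, letters e.lhs = keep K p.1 ∧ letters e.rhs = keep K p.2}

theorem deletions_finite {E : Set (List ℕ × List ℕ)} (hE : E.Finite) : (deletions E).Finite := by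
  refine (hE.biUnion fun p _ => ((p.1.toFinset ∪ p.2.toFinset).powerset.finite_toSet.image
    fun K => (⟨word (keep K p.1), word (keep K p.2)⟩ : Identity))).subset ?_
  rintro e ⟨p, hp, K, h1, h2⟩
  refine Set.mem_biUnion hp ⟨K ∩ (p.1.toFinset ∪ p.2.toFinset),
    Finset.mem_powerset.2 Finset.inter_subset_right, ?_⟩
  have k1 : keep (K ∩ (p.1.toFinset ∪ p.2.toFinset)) p.1 = keep K p.1 :=
    keep_congr fun x hx => by simp [hx]
  have k2 : keep (K ∩ (p.1.toFinset ∪ p.2.toFinset)) p.2 = keep K p.2 :=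
    keep_congr fun x hx => by simp [hx]
  simp only [k1, k2, ← h1, ← h2, word_letters]

/-- A substitution that erases letters is a deletion followed by a substitution of nonempty words,
and `deletions E` already contains the deleted identity. As both sides of a pair in `E` have the
same letters, they become empty together. -/
theorem listDerives_deletions_subst {E : Set (List ℕ × List ℕ)}
    (hE : ∀ p ∈ E, ∀ x, x ∈ p.1 ↔ x ∈ p.2) {u v : List ℕ} (ψ : ℕ → List ℕ)
    (h : ListDerives (deletions E) u v) :
    ListDerives (deletions E) (u.flatMap ψ) (v.flatMap ψ) := by
  rcases h with ⟨rfl, rfl⟩ | ⟨U, V, rfl, rfl, h⟩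
  · exact Or.inl ⟨rfl, rfl⟩
  induction h with
  | refl u => exact ListDerives.refl _ _
  | symm _ ih => exact (listDerives_equivalence _).symm ih
  | trans _ _ ih1 ih2 => exact (listDerives_equivalence _).trans ih1 ih2
  | mul _ _ ih1 ih2 =>
    rw [letters_mul, letters_mul, List.flatMap_append, List.flatMap_append]
    exact ih1.append ih2
  | subst e he φ =>
    obtain ⟨p, hp, K, h1, h2⟩ := he
    rw [letters_lift, letters_lift, List.flatMap_assoc, List.flatMap_assoc, h1, h2]
    set χ : ℕ → List ℕ := fun x => (letters (φ x)).flatMap ψ with hχ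
    set M := K.filter fun x => χ x ≠ [] with hM
    have key : ∀ l : List ℕ, (keep K l).flatMap χ =
        (keep M l).flatMap fun x => letters (word (χ x)) := by
      intro l
      rw [flatMap_keep, flatMap_keep]
      refine flatMap_congr_mem fun x _ => ?_
      by_cases hx : χ x = []
      · simp [hM, hx]
      · simp [hM, hx, letters_word hx]
    rw [key, key]
    have hnil : keep M p.1 = [] ↔ keep M p.2 = [] := by
      simp only [keep_eq_nil, hE p hp]
    by_cases h0 : keep M p.1 = []
    · exact Or.inl (by simp [h0, hnil.1 h0])
    · have h0' : keep M p.2 ≠ [] := fun h => h0 (hnil.2 h)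
      rw [← letters_word h0, ← letters_word h0', ← letters_lift, ← letters_lift,
        listDerives_letters]
      have hdel : (⟨word (keep M p.1), word (keep M p.2)⟩ : Identity) ∈ deletions E :=
        ⟨p, hp, M, letters_word h0, letters_word h0'⟩
      exact Derives.subst _ hdel fun x => word (χ x)

theorem listDerives_deletions_of_mem {E : Set (List ℕ × List ℕ)}
    (hE : ∀ p ∈ E, ∀ x, x ∈ p.1 ↔ x ∈ p.2) {p : List ℕ × List ℕ} (hp : p ∈ E) :
    ListDerives (deletions E) p.1 p.2 := by
  by_cases h0 : p.1 = []
  · refine Or.inl ⟨h0, ?_⟩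
    rw [List.eq_nil_iff_forall_not_mem]
    intro x hx
    rw [← hE p hp, h0] at hx
    simp at hx
  · have h0' : p.2 ≠ [] := by
      obtain ⟨x, hx⟩ := List.exists_mem_of_ne_nil _ h0
      exact List.ne_nil_of_mem ((hE p hp x).1 hx)
    refine Or.inr ⟨word p.1, word p.2, letters_word h0, letters_word h0', ?_⟩
    have hdel : (⟨word p.1, word p.2⟩ : Identity) ∈ deletions E :=
      ⟨p, hp, p.1.toFinset, by rw [letters_word h0, keep_eq_self fun x hx => by simpa using hx],
        by rw [letters_word h0', keep_eq_self fun x hx => by simpa [hE p hp] using hx]⟩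
    have := Derives.subst _ hdel FreeSemigroup.of
    have hof : ∀ u : Word, FreeSemigroup.lift FreeSemigroup.of u = u := fun u =>
      letters_injective (by rw [letters_lift]; exact flatMap_id fun x _ => rfl)
    rwa [hof, hof] at this

theorem isFI_listDerives_deletions {E : Set (List ℕ × List ℕ)}
    (hE : ∀ p ∈ E, ∀ x, x ∈ p.1 ↔ x ∈ p.2) : IsFI (ListDerives (deletions E)) where
  equiv := listDerives_equivalence _
  append p q h := ((ListDerives.refl _ p).append h).append (ListDerives.refl _ q)
  subst ψ h := listDerives_deletions_subst hE ψ h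

/-! ### The shape of the basis identities -/

theorem almostLinear_of_count {e : Identity} {x : ℕ}
    (h : ∀ z, z ≠ x → (letters e.lhs).count z ≤ 1 ∧ (letters e.rhs).count z ≤ 1) :
    AlmostLinear e := by
  constructor <;> intro a ha b hb <;> by_contra hab <;>
    simp only [non, occ, Set.mem_ofPred_eq] at ha hb <;>
    by_cases hax : a = x
  · have := (h b fun hb => hab (hax.trans hb.symm)).1; omega
  · have := (h a hax).1; omega
  · have := (h b fun hb => hab (hax.trans hb.symm)).2; omega
  · have := (h a hax).2; omega

theorem blockBalanced_of_isSwap {e : Identity} (h : IsSwap (letters e.lhs) (letters e.rhs)) :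
    BlockBalanced e ∧ HasTwoNonlinear e := by
  obtain ⟨p, q, c, y, h1, h2, hcy, hc, hy, hz⟩ := h
  have hc' := List.count_pos_iff.2 hc
  have hy' := List.count_pos_iff.2 hy
  rw [List.count_append] at hc' hy'
  constructor
  · intro x
    have hcl : c ∉ lin e.lhs := by
      simp only [lin, occ, h1, Set.mem_ofPred_eq, List.count_append, List.count_cons_self,
        List.count_cons_of_ne hcy.symm]
      omega
    have hyl : y ∉ lin e.lhs := by
      simp only [lin, occ, h1, Set.mem_ofPred_eq, List.count_append, List.count_cons_self,
        List.count_cons_of_ne hcy]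
      omega
    simp only [restrict]
    rw [h1, h2, List.filter_append, List.filter_append, List.filter_cons, List.filter_cons,
      List.filter_cons, List.filter_cons]
    by_cases hcx : c = x
    · have hyx : y ≠ x := fun h => hcy (hcx.trans h.symm)
      simp [hyx, hyl]
    · simp [hcx, hcl]
  · refine ⟨c, y, hcy, ?_, ?_⟩ <;> ext z <;>
      simp only [non, occ, h1, h2, Set.mem_ofPred_eq, Set.mem_insert_iff, Set.mem_singleton_iff,
        List.count_append, List.count_cons] <;>
      by_cases hzc : z = c <;> by_cases hzy : z = y
    any_goals
      subst hzc
      simp; omega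
    any_goals
      subst hzy
      simp; omega
    all_goals
      have := hz z hzc hzy
      rw [List.count_append] at this
      simp [hzc, hzy, Ne.symm hzc, Ne.symm hzy]; omega

/-- Deleting one of the two swapped letters leaves at most one non-linear letter, so closing under
deletions does not leave the permitted class. -/
theorem IsSwap.keep {l r : List ℕ} (h : IsSwap l r) (K : Finset ℕ) :
    IsSwap (keep K l) (keep K r) ∨
      ∃ x, ∀ z, z ≠ x → (keep K l).count z ≤ 1 ∧ (keep K r).count z ≤ 1 := by
  obtain ⟨p, q, c, y, rfl, rfl, hcy, hc, hy, hz⟩ := h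
  have hle : ∀ z, z ∉ K → ∀ l : List ℕ, (SemigroupIdentity.keep K l).count z = 0 := fun z hz l =>
    List.count_eq_zero.2 (by simp [hz])
  have hle' : ∀ z, z ≠ c → z ≠ y → (p ++ c :: y :: q).count z ≤ 1 ∧
      (p ++ y :: c :: q).count z ≤ 1 := by
    intro z hzc hzy
    have := hz z hzc hzy
    simp only [List.count_append, List.count_cons_of_ne hzc.symm,
      List.count_cons_of_ne hzy.symm] at this ⊢
    exact ⟨this, this⟩
  have hle'' : ∀ z l, (SemigroupIdentity.keep K l).count z ≤ l.count z := fun z l =>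
    List.filter_sublist.count_le z
  by_cases hcK : c ∈ K
  · by_cases hyK : y ∈ K
    · left
      refine ⟨SemigroupIdentity.keep K p, SemigroupIdentity.keep K q, c, y, ?_, ?_, hcy, ?_, ?_,
        fun z h1 h2 => ?_⟩
      · rw [keep_append, keep_cons_of_mem hcK, keep_cons_of_mem hyK]
      · rw [keep_append, keep_cons_of_mem hyK, keep_cons_of_mem hcK]
      · rw [← keep_append]; exact mem_keep.2 ⟨hc, hcK⟩
      · rw [← keep_append]; exact mem_keep.2 ⟨hy, hyK⟩
      · rw [← keep_append]; exact (hle'' z _).trans (hz z h1 h2)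
    · right
      refine ⟨c, fun z hzc => ?_⟩
      by_cases hzy : z = y
      · subst hzy; rw [hle _ hyK, hle _ hyK]; simp
      · exact ⟨(hle'' z _).trans (hle' z hzc hzy).1, (hle'' z _).trans (hle' z hzc hzy).2⟩
  · right
    refine ⟨y, fun z hzy => ?_⟩
    by_cases hzc : z = c
    · subst hzc; rw [hle _ hcK, hle _ hcK]; simp
    · exact ⟨(hle'' z _).trans (hle' z hzc hzy).1, (hle'' z _).trans (hle' z hzc hzy).2⟩

/-! ### The non-commutative case -/

/-- The identities of `S` have a finite basis of almost-linear identities and of block-balanced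
identities with two non-linear variables. -/
def HasSimpleBasis (S : Type*) [Semigroup S] : Prop :=
  ∃ B : Set Identity, B.Finite ∧ IsBasis B (equationalTheory S) ∧
    ∀ e ∈ B, AlmostLinear e ∨ (BlockBalanced e ∧ HasTwoNonlinear e)

theorem hasSimpleBasis_of_not_comm {S : Type*} [Monoid S] (hT : IsSigmaFI (MonId S))
    (hnc : ¬∀ a b : S, a * b = b * a) : HasSimpleBasis S := by
  obtain ⟨E1, hE1, hE1', hal⟩ := exists_finite_almostLinear hT.toIsFI
  obtain ⟨E2, hE2, hE2', hsw⟩ := exists_finite_swaps hT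
  obtain ⟨E3, hE3, hE3', hpow⟩ : ∃ E : Set (List ℕ × List ℕ), E.Finite ∧
      (∀ e ∈ E, MonId S e.1 e.2 ∧ ∃ x, ∀ z, z ≠ x → e.1.count z ≤ 1 ∧ e.2.count z ≤ 1) ∧
      ∀ n, 2 ≤ n → MonId S [0] (List.replicate n 0) →
        ∃ n, 2 ≤ n ∧ ([0], List.replicate n 0) ∈ E := by
    by_cases hex : ∃ n, 2 ≤ n ∧ MonId S [0] (List.replicate n 0)
    · obtain ⟨n, hn, hTn⟩ := hex
      refine ⟨{([0], List.replicate n 0)}, Set.finite_singleton _, ?_, fun _ _ _ => ⟨n, hn, rfl⟩⟩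
      rintro e rfl
      refine ⟨hTn, 0, fun z hz => ?_⟩
      simp [List.count_replicate, Ne.symm hz]
    · exact ⟨∅, Set.finite_empty, by simp, fun n hn h => absurd ⟨n, hn, h⟩ hex⟩
  set E4 : Set (List ℕ × List ℕ) := {([0, 1, 2, 0, 3, 1], [1, 0, 2, 0, 3, 1]),
    ([0, 2, 0, 1, 3, 1], [0, 2, 1, 0, 3, 1])} with hE4
  have hE4' : ∀ e ∈ E4, MonId S e.1 e.2 ∧ IsSwap e.1 e.2 := by
    rintro e (rfl | rfl)
    · refine ⟨hT.sigmaOne, [], [2, 0, 3, 1], 0, 1, rfl, rfl, by decide, by simp, by simp, ?_⟩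
      exact fun z _ _ => List.nodup_iff_count_le_one.1 (by decide) z
    · refine ⟨hT.sigmaMu, [0, 2], [3, 1], 0, 1, rfl, rfl, by decide, by simp, by simp, ?_⟩
      exact fun z _ _ => List.nodup_iff_count_le_one.1 (by decide) z
  set E := (E1 ∪ E3) ∪ (E2 ∪ E4) with hE
  have hET : ∀ e ∈ E, MonId S e.1 e.2 := by
    rintro e ((h | h) | (h | h))
    exacts [(hE1' e h).1, (hE3' e h).1, (hE2' e h).1, (hE4' e h).1]
  have hmem : ∀ e ∈ E, ∀ x, x ∈ e.1 ↔ x ∈ e.2 := fun e he x =>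
    mem_iff_of_monId hT.sigmaOne hnc (hET e he) x
  refine ⟨deletions E, deletions_finite (((hE1.union hE3).union (hE2.union (by simp [hE4])))),
    ⟨?_, ?_⟩, ?_⟩
  · rintro e ⟨p, hp, K, h1, h2⟩
    change Satisfies S e
    rw [satisfies_iff, h1, h2]
    exact hT.keep K (hET p hp)
  · intro e he
    have hfi := isFI_listDerives_deletions hmem
    have hR : ∀ p ∈ E, ListDerives (deletions E) p.1 p.2 ∧ MonId S p.1 p.2 := fun p hp =>
      ⟨listDerives_deletions_of_mem hmem hp, hET p hp⟩
    -- Intersecting derivability with `MonId S` gives `R ⊆ T` without a separate soundness proof for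
    -- derivations.
    have hRfi : IsSigmaFI fun u v => ListDerives (deletions E) u v ∧ MonId S u v :=
      { equiv := ⟨fun u => ⟨hfi.refl u, hT.refl u⟩, fun h => ⟨hfi.symm h.1, hT.symm h.2⟩,
          fun h h' => ⟨hfi.trans h.1 h'.1, hT.trans h.2 h'.2⟩⟩
        append := fun p q h => ⟨hfi.append p q h.1, hT.append p q h.2⟩
        subst := fun φ h => ⟨hfi.subst φ h.1, hT.subst φ h.2⟩
        sigmaOne := hR _ (Or.inr (Or.inr (Or.inl rfl)))
        sigmaMu := hR _ (Or.inr (Or.inr (Or.inr rfl))) }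
    have := of_monId hT hnc hRfi (fun u v h => h.2)
      (hal _ hRfi.toIsFI (fun u v h => h.2) fun p hp => hR p (Or.inl (Or.inl hp)))
      (hsw _ hRfi fun p hp => hR p (Or.inr (Or.inl hp)))
      (fun n hn h => by
        obtain ⟨m, hm, hmE⟩ := hpow n hn h
        exact ⟨m, hm, hR _ (Or.inl (Or.inr hmE))⟩)
      ((satisfies_iff e).1 he)
    exact listDerives_letters.1 this.1
  · rintro e ⟨p, hp, K, h1, h2⟩
    have hcases : (∃ x, ∀ z, z ≠ x → p.1.count z ≤ 1 ∧ p.2.count z ≤ 1) ∨ IsSwap p.1 p.2 := by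
      rcases hp with (h | h) | (h | h)
      exacts [Or.inl (hE1' p h).2, Or.inl (hE3' p h).2, Or.inr (hE2' p h).2, Or.inr (hE4' p h).2]
    rcases hcases with ⟨x, hx⟩ | hs
    · left
      refine almostLinear_of_count (x := x) fun z hz => ?_
      rw [h1, h2]
      exact ⟨(List.filter_sublist.count_le z).trans (hx z hz).1,
        (List.filter_sublist.count_le z).trans (hx z hz).2⟩
    · rcases hs.keep K with hs | ⟨x, hx⟩
      · right
        rw [← h1, ← h2] at hs
        exact blockBalanced_of_isSwap hs
      · left
        rw [← h1, ← h2] at hx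
        exact almostLinear_of_count hx

/-! ### The commutative case -/

section Commutative

theorem of_list_perm (heq : Equivalence R)
    (happ : ∀ {u v : List ℕ} (p q : List ℕ), R u v → R (p ++ u ++ q) (p ++ v ++ q))
    (hswap : ∀ x y, R [x, y] [y, x]) {u v : List ℕ} (h : u.Perm v) : R u v := by
  induction h with
  | nil => exact heq.refl _
  | cons x _ ih => simpa using happ [x] [] ih
  | swap x y l => simpa using happ [] l (hswap y x)
  | trans _ _ ih1 ih2 => exact heq.trans ih1 ih2

/-- `x ^ a ≈ x ^ b` holds in `S` for some `b < a`. -/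
def PowReducible (S : Type*) [Monoid S] (a : ℕ) : Prop :=
  ∃ b < a, MonId S (List.replicate a 0) (List.replicate b 0)

variable {S : Type*} [Monoid S]

/-- Up to order a word is determined by its exponents. Each reducible exponent can be lowered, and
two irreducible exponents that `S` identifies are equal. Invariance of `R` under substitution is not
required, which allows the relation used in `isBasis_of_comm_of_zero`. -/
theorem of_monId_of_comm (heq : Equivalence R)
    (happ : ∀ {u v : List ℕ} (p q : List ℕ), R u v → R (p ++ u ++ q) (p ++ v ++ q))
    (hswap : ∀ x y, R [x, y] [y, x]) (hRT : ∀ u v, R u v → MonId S u v)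
    (hpow : ∀ a, PowReducible S a →
      ∃ n b, b < n ∧ n ≤ a ∧ ∀ x, R (List.replicate n x) (List.replicate b x))
    {u v : List ℕ} (h : MonId S u v) : R u v := by
  have red : ∀ (N : ℕ) (u : List ℕ), u.length ≤ N →
      ∃ u', R u u' ∧ ∀ x, ¬ PowReducible S (u'.count x) := by
    intro N
    induction N with
    | zero =>
      intro u hu
      obtain rfl := List.length_eq_zero_iff.1 (Nat.le_zero.1 hu)
      exact ⟨[], heq.refl _, fun x ⟨b, hb, _⟩ => by simp at hb⟩
    | succ N ih =>
      intro u hu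
      by_cases hred : ∃ x, PowReducible S (u.count x)
      · obtain ⟨x, hx⟩ := hred
        obtain ⟨n, b, hbn, hn, hRn⟩ := hpow _ hx
        have hperm := List.filter_append_perm (fun z => decide (z ∈ ({x} : Finset ℕ))) u
        set w := u.filter fun z => !decide (z ∈ ({x} : Finset ℕ))
        change (keep {x} u ++ w).Perm u at hperm
        have hlen := hperm.length_eq
        rw [keep_singleton, ← Nat.add_sub_cancel' hn, List.replicate_add] at hperm
        have h1 := of_list_perm heq happ hswap hperm.symm
        have h2 := happ [] (List.replicate (u.count x - n) x ++ w) (hRn x)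
        simp only [List.nil_append, ← List.append_assoc] at h1 h2
        obtain ⟨u', hu', hirr⟩ := ih
          (List.replicate b x ++ List.replicate (u.count x - n) x ++ w) (by
            rw [keep_singleton] at hlen
            simp only [List.length_append, List.length_replicate] at hlen ⊢
            omega)
        exact ⟨u', heq.trans h1 (heq.trans h2 hu'), hirr⟩
      · exact ⟨u, heq.refl _, fun x hx => hred ⟨x, hx⟩⟩
  obtain ⟨u', hu, hu'⟩ := red _ u le_rfl
  obtain ⟨v', hv, hv'⟩ := red _ v le_rfl
  have hT : IsFI (MonId S) := isFI_monId
  have h' : MonId S u' v' := hT.trans (hT.symm (hRT _ _ hu)) (hT.trans h (hRT _ _ hv))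
  refine heq.trans hu (heq.trans (of_list_perm heq happ hswap ?_) (heq.symm hv))
  rw [List.perm_iff_count]
  intro x
  have hx : MonId S (List.replicate (u'.count x) 0) (List.replicate (v'.count x) 0) := by
    have := hT.keep {x} h'
    rw [keep_singleton, keep_singleton] at this
    intro φ
    simpa using this fun _ => φ 0
  by_contra hne
  rcases Nat.lt_or_gt_of_ne hne with hlt | hlt
  · exact hv' x ⟨_, hlt, hT.symm hx⟩
  · exact hu' x ⟨_, hlt, hx⟩

/-- The identity `x y ≈ y x`. -/
def commIdentity : Identity := ⟨⟨0, [1]⟩, ⟨1, [0]⟩⟩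

theorem Derives.comm {B : Set Identity} (h : commIdentity ∈ B) (U V : Word) :
    Derives B (U * V) (V * U) := by
  have := Derives.subst _ h fun | 0 => U | _ => V
  have h2 : ∀ (f : ℕ → Word) (x y : ℕ), FreeSemigroup.lift f ⟨x, [y]⟩ = f x * f y :=
    fun f x y => rfl
  rwa [commIdentity, h2, h2] at this

theorem word_append {u v : List ℕ} (hu : u ≠ []) (hv : v ≠ []) :
    word (u ++ v) = word u * word v :=
  letters_injective (by
    rw [letters_mul, letters_word hu, letters_word hv, letters_word (by simp [hu])])

theorem listDerives_word {B : Set Identity} {u v : List ℕ} (hu : u ≠ []) (hv : v ≠ []) :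
    ListDerives B u v ↔ Derives B (word u) (word v) := by
  rw [← listDerives_letters, letters_word hu, letters_word hv]

theorem ListDerives.comm {B : Set Identity} (h : commIdentity ∈ B) (u v : List ℕ) :
    ListDerives B (u ++ v) (v ++ u) := by
  by_cases hu : u = []
  · subst hu; simpa using ListDerives.refl B v
  by_cases hv : v = []
  · subst hv; simpa using ListDerives.refl B u
  rw [listDerives_word (by simp [hu]) (by simp [hv]), word_append hu hv, word_append hv hu]
  exact Derives.comm h _ _

theorem isBasis_of_comm_of_pos {B : Set Identity} (hB : B ⊆ equationalTheory S)
    (hcomm : commIdentity ∈ B)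
    (hpow : ∀ a, PowReducible S a → ∃ n b, 0 < b ∧ b < n ∧ n ≤ a ∧
      (⟨word (List.replicate n 0), word (List.replicate b 0)⟩ : Identity) ∈ B) :
    IsBasis B (equationalTheory S) := by
  refine ⟨hB, fun e he => ?_⟩
  have hT : IsFI (MonId S) := isFI_monId
  have heq := listDerives_equivalence B
  have := of_monId_of_comm (S := S) (R := fun u v => ListDerives B u v ∧ MonId S u v)
    ⟨fun u => ⟨heq.refl u, hT.refl u⟩, fun h => ⟨heq.symm h.1, hT.symm h.2⟩,
      fun h h' => ⟨heq.trans h.1 h'.1, hT.trans h.2 h'.2⟩⟩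
    (fun p q h => ⟨((ListDerives.refl B p).append h.1).append (ListDerives.refl B q),
      hT.append p q h.2⟩)
    (fun x y => ⟨by simpa using ListDerives.comm hcomm [x] [y], by
      have h1 := (satisfies_iff _).1 (hB hcomm)
      have := hT.subst (fun | 0 => [x] | _ => [y]) h1
      simpa [commIdentity, letters] using this⟩)
    (fun u v h => h.2)
    (fun a ha => by
      obtain ⟨n, b, hb, hbn, hna, hmem⟩ := hpow a ha
      refine ⟨n, b, hbn, hna, fun x => ?_⟩
      have hn0 : List.replicate n 0 ≠ [] := by simp; omega
      have hb0 : List.replicate b 0 ≠ [] := by simp; omega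
      constructor
      · have h1 := Derives.subst _ hmem fun _ => FreeSemigroup.of x
        rw [← listDerives_letters, letters_lift, letters_lift, letters_word hn0,
          letters_word hb0] at h1
        rwa [flatMap_replicate (x' := x) rfl, flatMap_replicate (x' := x) rfl] at h1
      · have h1 := (satisfies_iff _).1 (hB hmem)
        rw [letters_word hn0, letters_word hb0] at h1
        have := hT.subst (fun _ => [x]) h1
        rwa [flatMap_replicate rfl, flatMap_replicate rfl] at this)
    ((satisfies_iff e).1 he)
  exact listDerives_letters.1 this.1

/-- Here `xⁿ ≈ 1` holds, which is not a semigroup identity; `xⁿ y ≈ y` replaces it. -/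
theorem isBasis_of_comm_of_zero {B : Set Identity} (hB : B ⊆ equationalTheory S)
    (hcomm : commIdentity ∈ B) {n : ℕ} (hn : 0 < n) (hmin : ∀ a, PowReducible S a → n ≤ a)
    (hpow : (⟨word (List.replicate n 0 ++ [1]), word [1]⟩ : Identity) ∈ B) :
    IsBasis B (equationalTheory S) := by
  refine ⟨hB, fun e he => ?_⟩
  have hT : IsFI (MonId S) := isFI_monId
  have heq := listDerives_equivalence B
  have hcancel : ∀ (x : ℕ) (q : List ℕ), q ≠ [] → ListDerives B (List.replicate n x ++ q) q := by
    intro x q hq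
    have h1 := Derives.subst _ hpow fun | 0 => FreeSemigroup.of x | _ => word q
    rw [← listDerives_letters, letters_lift, letters_lift, letters_word (by simp),
      letters_word (by simp), List.flatMap_append, flatMap_replicate (x' := x) rfl] at h1
    simpa [letters_word hq] using h1
  have hpowT : MonId S (List.replicate n 0) [] := by
    have h1 := (satisfies_iff _).1 (hB hpow)
    rw [letters_word (by simp), letters_word (by simp)] at h1
    have := hT.keep {0} h1
    rwa [keep_singleton, keep_singleton, List.count_append, List.count_replicate_self] at this
  -- Since `xⁿ` can be cancelled only in front of a nonempty word, the relation asks for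
  -- derivability in every context with a nonempty right part. The context `W = xⁿ` is removed at
  -- the end.
  have key := of_monId_of_comm (S := S)
    (R := fun u v => (∀ p q, q ≠ [] → ListDerives B (p ++ u ++ q) (p ++ v ++ q)) ∧ MonId S u v)
    ⟨fun u => ⟨fun _ _ _ => heq.refl _, hT.refl u⟩,
      fun h => ⟨fun p q hq => heq.symm (h.1 p q hq), hT.symm h.2⟩,
      fun h h' => ⟨fun p q hq => heq.trans (h.1 p q hq) (h'.1 p q hq), hT.trans h.2 h'.2⟩⟩
    (fun p q h => ⟨fun p' q' hq => by
      have := h.1 (p' ++ p) (q ++ q') (by simp [hq])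
      simpa using this, hT.append p q h.2⟩)
    (fun x y => ⟨fun p q _ => ((ListDerives.refl B p).append
        (by simpa using ListDerives.comm hcomm [x] [y])).append (ListDerives.refl B q), by
      have h1 := (satisfies_iff _).1 (hB hcomm)
      have := hT.subst (fun | 0 => [x] | _ => [y]) h1
      simpa [commIdentity, letters] using this⟩)
    (fun u v h => h.2)
    (fun a ha => ⟨n, 0, hn, hmin a ha, fun x => ⟨fun p q hq => by
        have := (ListDerives.refl B p).append (hcancel x q hq)
        simpa using this, by
        have := hT.subst (fun _ => [x]) hpowT
        rwa [flatMap_replicate rfl] at this⟩⟩)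
    ((satisfies_iff e).1 he)
  set W := List.replicate n 0 with hW
  have hW0 : W ≠ [] := by simp [hW]; omega
  have h1 := hcancel 0 (letters e.lhs) (letters_ne_nil _)
  have h2 := hcancel 0 (letters e.rhs) (letters_ne_nil _)
  have h3 := key.1 [] W hW0
  have h4 := ListDerives.comm hcomm W (letters e.lhs)
  have h5 := ListDerives.comm hcomm (letters e.rhs) W
  rw [List.nil_append, List.nil_append] at h3
  exact listDerives_letters.1
    (heq.trans (heq.symm h1) (heq.trans h4 (heq.trans h3 (heq.trans h5 h2))))

theorem hasSimpleBasis_of_comm (hc : ∀ a b : S, a * b = b * a) : HasSimpleBasis S := by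
  have hcommS : commIdentity ∈ equationalTheory S := by
    change Satisfies S _
    rw [satisfies_iff]
    intro φ
    simp [commIdentity, letters, hc (φ 0)]
  have hcommAL : AlmostLinear commIdentity := by
    refine almostLinear_of_count (x := 0) fun z _ => ?_
    exact ⟨List.nodup_iff_count_le_one.1 (by decide) z, List.nodup_iff_count_le_one.1 (by decide) z⟩
  by_cases hred : ∃ a, PowReducible S a
  · classical
    set n := Nat.find hred with hn
    -- With `n` least, `xⁿ ≈ xᵇ` lowers every reducible exponent, because all of them are at least
    -- `n`.
    obtain ⟨b, hbn, hb⟩ := Nat.find_spec hred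
    have hmin : ∀ a, PowReducible S a → n ≤ a := fun a ha => Nat.find_min' hred ha
    rw [← hn] at hbn hb
    have hcount : ∀ m z : ℕ, z ≠ 0 → (List.replicate m 0).count z = 0 := fun m z hz => by
      rw [List.count_replicate]; simp [hz.symm]
    rcases Nat.eq_zero_or_pos b with rfl | hb0
    · refine ⟨{commIdentity, ⟨word (List.replicate n 0 ++ [1]), word [1]⟩}, by simp,
        isBasis_of_comm_of_zero ?_ (Or.inl rfl) hbn hmin (Or.inr rfl), ?_⟩
      · rintro e (rfl | rfl)
        · exact hcommS
        · change Satisfies S _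
          rw [satisfies_iff, letters_word (by simp), letters_word (by simp)]
          simpa using isFI_monId.append [] [1] hb
      · rintro e (rfl | rfl)
        · exact Or.inl hcommAL
        · refine Or.inl (almostLinear_of_count (x := 0) fun z hz => ?_)
          rw [letters_word (by simp), letters_word (by simp), List.count_append, hcount n z hz]
          have := List.nodup_iff_count_le_one.1 (List.nodup_singleton 1) z
          omega
    · have hn0 : List.replicate n 0 ≠ [] := by simp; omega
      have hb0' : List.replicate b 0 ≠ [] := by simp; omega
      refine ⟨{commIdentity, ⟨word (List.replicate n 0), word (List.replicate b 0)⟩}, by simp,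
        isBasis_of_comm_of_pos ?_ (Or.inl rfl)
          (fun a ha => ⟨n, b, hb0, hbn, hmin a ha, Or.inr rfl⟩), ?_⟩
      · rintro e (rfl | rfl)
        · exact hcommS
        · change Satisfies S _
          rwa [satisfies_iff, letters_word hn0, letters_word hb0']
      · rintro e (rfl | rfl)
        · exact Or.inl hcommAL
        · refine Or.inl (almostLinear_of_count (x := 0) fun z hz => ?_)
          rw [letters_word hn0, letters_word hb0', hcount n z hz, hcount b z hz]
          simp
  · refine ⟨{commIdentity}, Set.finite_singleton _,
      isBasis_of_comm_of_pos (by simpa using hcommS) rfl fun a ha => absurd ⟨a, ha⟩ hred, ?_⟩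
    rintro e rfl
    exact Or.inl hcommAL

end Commutative

theorem hasSimpleBasis_of_sigmaOne {S : Type*} [Monoid S] (h1 : Satisfies S sigmaOne)
    (h2 : Satisfies S sigmaMu) : HasSimpleBasis S := by
  by_cases hc : ∀ a b : S, a * b = b * a
  · exact hasSimpleBasis_of_comm hc
  · exact hasSimpleBasis_of_not_comm
      { toIsFI := isFI_monId
        sigmaOne := (satisfies_iff _).1 h1
        sigmaMu := (satisfies_iff _).1 h2 } hc

/-! ### Duality -/

section Dual

/-- The reversal of a word. -/
def revWord (u : Word) : Word := word (letters u).reverse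

/-- The reversal of an identity. -/
def revIdentity (e : Identity) : Identity := ⟨revWord e.lhs, revWord e.rhs⟩

theorem letters_revWord (u : Word) : letters (revWord u) = (letters u).reverse :=
  letters_word (by simp [letters_ne_nil])

theorem revWord_revWord (u : Word) : revWord (revWord u) = u :=
  letters_injective (by rw [letters_revWord, letters_revWord, List.reverse_reverse])

theorem revWord_mul (u v : Word) : revWord (u * v) = revWord v * revWord u :=
  letters_injective (by
    rw [letters_revWord, letters_mul, letters_mul, letters_revWord, letters_revWord,
      List.reverse_append])

theorem revWord_lift (φ : ℕ → Word) (u : Word) :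
    revWord (FreeSemigroup.lift φ u) = FreeSemigroup.lift (fun x => revWord (φ x)) (revWord u) :=
  letters_injective (by
    rw [letters_revWord, letters_lift, letters_lift, letters_revWord, List.reverse_flatMap]
    exact flatMap_congr_mem fun x _ => (letters_revWord _).symm)

theorem Derives.rev {B : Set Identity} {u v : Word} (h : Derives B u v) :
    Derives (revIdentity '' B) (revWord u) (revWord v) := by
  induction h with
  | subst e he φ =>
    rw [revWord_lift, revWord_lift]
    exact Derives.subst (revIdentity e) (Set.mem_image_of_mem _ he) _
  | refl u => exact .refl _
  | symm _ ih => exact ih.symm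
  | trans _ _ ih1 ih2 => exact ih1.trans ih2
  | mul _ _ ih1 ih2 => rw [revWord_mul, revWord_mul]; exact ih2.mul ih1

theorem satisfies_op_revIdentity {S : Type*} [Monoid S] {e : Identity} :
    Satisfies Sᵐᵒᵖ (revIdentity e) ↔ Satisfies S e := by
  rw [satisfies_iff, satisfies_iff]
  have key : ∀ (u : Word) (φ : ℕ → Sᵐᵒᵖ), ((letters (revWord u)).map φ).prod.unop =
      ((letters u).map fun x => (φ x).unop).prod := by
    intro u φ
    rw [MulOpposite.unop_list_prod, letters_revWord, List.map_reverse, List.map_reverse,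
      List.reverse_reverse, List.map_map]
    rfl
  constructor
  · intro h φ
    have := congrArg MulOpposite.unop (h fun x => MulOpposite.op (φ x))
    simp only [revIdentity] at this
    rwa [key, key] at this
  · intro h φ
    apply MulOpposite.unop_injective
    simp only [revIdentity]
    rw [key, key]
    exact h _

theorem occ_revWord (u : Word) (x : ℕ) : occ (revWord u) x = occ u x := by
  rw [occ, letters_revWord, List.count_reverse, occ]

theorem non_revWord (u : Word) : non (revWord u) = non u := by
  simp only [non, occ_revWord]

theorem lin_revWord (u : Word) : lin (revWord u) = lin u := by
  simp only [lin, occ_revWord]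

theorem restrict_revWord (u : Word) (X : Set ℕ) : restrict (revWord u) X = (restrict u X).reverse := by
  rw [restrict, letters_revWord, List.filter_reverse, restrict]

theorem AlmostLinear.rev {e : Identity} (h : AlmostLinear e) : AlmostLinear (revIdentity e) := by
  simpa only [AlmostLinear, AlmostLinearWord, revIdentity, non_revWord] using h

theorem BlockBalanced.rev {e : Identity} (h : BlockBalanced e) : BlockBalanced (revIdentity e) := by
  intro x
  simp only [revIdentity, lin_revWord, restrict_revWord, h x]

theorem HasTwoNonlinear.rev {e : Identity} (h : HasTwoNonlinear e) :
    HasTwoNonlinear (revIdentity e) := by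
  simpa only [HasTwoNonlinear, revIdentity, non_revWord] using h

theorem HasSimpleBasis.of_op {S : Type*} [Monoid S] (h : HasSimpleBasis Sᵐᵒᵖ) :
    HasSimpleBasis S := by
  obtain ⟨B, hB, ⟨hBS, hder⟩, hcls⟩ := h
  have hrev : ∀ e : Identity, revIdentity (revIdentity e) = e := fun e => by
    simp [revIdentity, revWord_revWord]
  refine ⟨revIdentity '' B, hB.image _, ⟨?_, fun e he => ?_⟩, ?_⟩
  · rintro _ ⟨e, he, rfl⟩
    have : Satisfies Sᵐᵒᵖ e := hBS he
    rw [← hrev e] at this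
    exact satisfies_op_revIdentity.1 this
  · have := (hder (revIdentity e) (satisfies_op_revIdentity.2 he)).rev
    simpa only [revIdentity, revWord_revWord] using this
  · rintro _ ⟨e, he, rfl⟩
    exact (hcls e he).imp AlmostLinear.rev fun h => ⟨h.1.rev, h.2.rev⟩

theorem hasSimpleBasis_of_sigmaTwo {S : Type*} [Monoid S] (h1 : Satisfies S sigmaMu)
    (h2 : Satisfies S sigmaTwo) : HasSimpleBasis S := by
  rw [satisfies_iff] at h1 h2
  refine HasSimpleBasis.of_op (hasSimpleBasis_of_sigmaOne ?_ ?_)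
  · rw [satisfies_iff]
    intro φ
    -- Reversal combined with the exchanges `x ↔ y` and `t₁ ↔ t₂` carries `σ₂` to `σ₁`, and `σ_μ` to
    -- itself.
    have := h2 fun | 0 => (φ 1).unop | 1 => (φ 0).unop | 2 => (φ 3).unop | _ => (φ 2).unop
    apply MulOpposite.unop_injective
    simpa [sigmaTwo, sigmaOne, letters, mul_assoc] using this
  · rw [satisfies_iff]
    intro φ
    have := h1 fun | 0 => (φ 1).unop | 1 => (φ 0).unop | 2 => (φ 3).unop | _ => (φ 2).unop
    apply MulOpposite.unop_injective
    simpa [sigmaMu, letters, mul_assoc] using this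

end Dual

end SemigroupIdentity

theorem mainTheorem1 (S : Type*) [Monoid S]
    (hS : (Satisfies S sigmaOne ∧ Satisfies S sigmaMu) ∨
      (Satisfies S sigmaMu ∧ Satisfies S sigmaTwo)) :
    FinitelyBased S ∧
      ∃ B : Set Identity, B.Finite ∧ IsBasis B (equationalTheory S) ∧
        ∀ e ∈ B, AlmostLinear e ∨ (BlockBalanced e ∧ HasTwoNonlinear e) := by
  have h : HasSimpleBasis S := by
    rcases hS with ⟨h1, h2⟩ | ⟨h1, h2⟩
    · exact hasSimpleBasis_of_sigmaOne h1 h2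
    · exact hasSimpleBasis_of_sigmaTwo h1 h2
  obtain ⟨B, hB, hbasis, -⟩ := id h
  exact ⟨⟨B, hB, hbasis⟩, h⟩
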